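/- Let $\mathbf{k}$ be a commutative ring, $\lambda\in\mathbf{k}$, and $X$ a set. A nonunitary Rota–Baxter algebra (of weight $\lambda$) is an associative, not necessarily unital, $\mathbf{k}$-algebra $A$ with a $\mathbf{k}$-linear operator $P:A\to A$ such that $P(x)P(y)=P(xP(y))+P(P(x)y)+\lambda P(xy)$ for all $x,y\in A$; morphisms are the algebra homomorphisms commuting with the operators. *Paths.* An $X$-decorated Motzkin path is a lattice path that starts and ends on the horizontal axis, never goes below it, and consists of up steps, down steps and level steps, the level steps being decorated by elements of $X$. Let $\circ$ be concatenation of paths and let $\langle m\rangle$ be the path $m$ raised by an up step before it and a down step after it. Let $\mathfrak{L}(X)$ be the set of peak-free paths (nontrivial paths with no up step immediately followed by a down step) and $\mathfrak{V}(X)$ the set of valley-free paths (no down step immediately followed by an up step). On $\mathbf{k}(\mathfrak{L}(X)\cap\mathfrak{V}(X))$ let $\diamond_p$ be the bilinear product defined recursively as follows. If $m=m_1\circ\cdots\circ m_p$ and $m'=m'_1\circ\cdots\circ m'_q$ are the decompositions into indecomposable paths (nontrivial paths that touch the axis only at their two ends), then $m\diamond_p m'=m_1\circ\cdots\circ m_{p-1}\circ(m_p\diamond_p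 m'_1)\circ m'_2\circ\cdots\circ m'_q$, where $m_p\diamond_p m'_1=m_p\circ m'_1$ if $m_p$ or $m'_1$ is a level step, and $$\langle a\rangle\diamond_p\langle b\rangle=\langle a\diamond_p\langle b\rangle\rangle+\langle\langle a\rangle\diamond_p b\rangle+\lambda\langle a\diamond_p b\rangle .$$ *Forests.* Let $\mathcal{F}(X)$ be the set of nonempty planar rooted forests (finite sequences of planar rooted trees) with leaves decorated by $X$; the one-vertex tree with decoration $x$ is denoted $\bullet_x$, and $\lfloor F\rfloor$ is the tree obtained by grafting the trees of $F$ to a new root. Let $\mathcal{F}_\ell(X)\subseteq\mathcal{F}(X)$ be the set of leaf-spaced forests: no vertex has two adjacent non-leaf branches, and no two adjacent trees of the forest are both different from one-vertex trees. On $\mathbf{k}\mathcal{F}_\ell(X)$ let $\diamond_\ell$ be the bilinear product defined recursively as follows. For forests $F=F_1\cdots F_b$ and $F'=F'_1\cdots F'_{b'}$ written as sequences of trees, $F\diamond_\ell F'=F_1\cdots F_{b-1}(F_b\diamond_\ell F'_1)F'_2\cdots F'_{b'}$, where $F_b\diamond_\ell F'_1=F_bF'_1$ if $F_b$ or $F'_1$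 is a one-vertex tree, and $$\lfloor G\rfloor\diamond_\ell\lfloor G'\rfloor=\lfloor G\diamond_\ell\lfloor G'\rfloor\rfloor+\lfloor\lfloor G\rfloor\diamond_\ell G'\rfloor+\lambda\lfloor G\diamond_\ell G'\rfloor .$$ Let $\phi:\mathfrak{L}(X)\to\mathcal{F}(X)$ be the unique map that sends the level step decorated by $x$ to $\bullet_x$ for every $x\in X$, sends $\circ$ to concatenation of forests, and sends raising to grafting. Then: 1. $\phi$ restricts to a bijection $\mathfrak{L}(X)\cap\mathfrak{V}(X)\to\mathcal{F}_\ell(X)$, and this bijection extends linearly to an isomorphism $(\mathbf{k}(\mathfrak{L}(X)\cap\mathfrak{V}(X)),\diamond_p,\langle\ \rangle)\to(\mathbf{k}\mathcal{F}_\ell(X),\diamond_\ell,\lfloor\ \rfloor)$ of nonunitary Rota–Baxter algebras of weight $\lambda$. 2. $(\mathbf{k}\mathcal{F}_\ell(X),\diamond_\ell,\lfloor\ \rfloor)$ with $j_X:X\to\mathcal{F}_\ell(X)$, $j_X(x)=\bullet_x$, is the free nonunitary Rota–Baxter algebra of weight $\lambda$ on $X$: for every nonunitary Rota–Baxter algebra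 $(R,Q)$ of weight $\lambda$ and every map $f:X\to R$ there is a unique morphism $\bar f:\mathbf{k}\mathcal{F}_\ell(X)\to R$ of nonunitary Rota–Baxter algebras with $\bar f\circ j_X=f$. -/

import Mathlib

universe u v w t

noncomputable section

/-! ### Nonunitary Rota-Baxter algebras -/

/-- The Rota-Baxter identity of weight `lam` for a linear operator `P`. -/
def RotaBaxterIdentity {k : Type v} [CommRing k] (lam : k) {A : Type w}
    [NonUnitalNonAssocRing A] [Module k A] (P : A →ₗ[k] A) : Prop :=
  ∀ x y : A, P x * P y = P (x * P y) + P (P x * y) + lam • P (x * y)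

/-- `(A, P)` is a nonunitary Rota-Baxter `k`-algebra of weight `lam`: the multiplication of `A` is
`k`-bilinear and associative, and `P` satisfies the Rota-Baxter identity. -/
structure IsNonunitaryRotaBaxterAlgebra {k : Type v} [CommRing k] (lam : k) {A : Type w}
    [NonUnitalNonAssocRing A] [Module k A] (P : A →ₗ[k] A) : Prop where
  smul_mul : ∀ (c : k) (x y : A), (c • x) * y = c • (x * y)
  mul_smul : ∀ (c : k) (x y : A), x * (c • y) = c • (x * y)
  mul_assoc : ∀ x y z : A, x * y * z = x * (y * z)
  rotaBaxter : RotaBaxterIdentity lam P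

/-! ### Free modules with a bilinear multiplication given on the basis -/

/-- The free `k`-module on `B`; it carries the bilinear multiplication whose value on a pair
of basis elements is given by `μ`. -/
def BasisAlgebra {k : Type v} [CommRing k] {B : Type u} (_μ : B → B → (B →₀ k)) :
    Type (max u v) :=
  B →₀ k

namespace BasisAlgebra

variable {k : Type v} [CommRing k] {B : Type u} (μ : B → B → (B →₀ k))

instance : AddCommGroup (BasisAlgebra μ) := inferInstanceAs (AddCommGroup (B →₀ k))

instance : Module k (BasisAlgebra μ) := inferInstanceAs (Module k (B →₀ k))

/-- The basis element of `b`. -/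
def of (b : B) : BasisAlgebra μ := (Finsupp.single b (1 : k) : B →₀ k)

/-- The bilinear extension of `μ`. -/
def mulBilin : (B →₀ k) →ₗ[k] (B →₀ k) →ₗ[k] (B →₀ k) :=
  Finsupp.linearCombination k fun b => Finsupp.linearCombination k fun c => μ b c

instance : NonUnitalNonAssocRing (BasisAlgebra μ) where
  mul a b := mulBilin μ a b
  left_distrib a b c := map_add (mulBilin μ a) b c
  right_distrib a b c := LinearMap.map_add₂ (mulBilin μ) a b c
  zero_mul a := LinearMap.map_zero₂ (mulBilin μ) a
  mul_zero a := map_zero (mulBilin μ a)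

/-- The linear extension of a map of bases `B → B`. -/
def mapBasis (g : B → B) : BasisAlgebra μ →ₗ[k] BasisAlgebra μ :=
  (Finsupp.lmapDomain k k g : (B →₀ k) →ₗ[k] (B →₀ k))

end BasisAlgebra

/-! ### Decorated Motzkin paths -/

/-- The steps of a lattice path whose level steps are decorated by `X`. -/
inductive MStep (X : Type u) : Type u where
  | up : MStep X
  | down : MStep X
  | level (x : X) : MStep X

namespace Motzkin

variable {X : Type u}

/-- The change of height along a step. -/
def rise : MStep X → ℤ
  | .up => 1
  | .down => -1
  | .level _ => 0

/-- The height of the end point of a path that starts at height `0`. -/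
def height (w : List (MStep X)) : ℤ := (w.map rise).sum

/-- Motzkin paths never go below the axis and end on it. -/
def IsMotzkin (w : List (MStep X)) : Prop :=
  (∀ n : ℕ, 0 ≤ height (w.take n)) ∧ height w = 0

/-- Nontrivial, and no up step is followed immediately by a down step. -/
def PeakFree (w : List (MStep X)) : Prop :=
  w ≠ [] ∧ w.IsChain fun s t => ¬ (s = .up ∧ t = .down)

/-- No down step is followed immediately by an up step. -/
def ValleyFree (w : List (MStep X)) : Prop :=
  w.IsChain fun s t => ¬ (s = .down ∧ t = .up)

/-- The link product of two paths. -/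
def link (m m' : List (MStep X)) : List (MStep X) := m ++ m'

/-- The raising operator on paths. -/
def raise (m : List (MStep X)) : List (MStep X) := MStep.up :: (m ++ [MStep.down])

/-- The first time after the start at which a path is at height `0`. -/
def firstReturn (w : List (MStep X)) : ℕ := sInf {n : ℕ | 0 < n ∧ height (w.take n) = 0}

/-- The last time before the end at which a path is at height `0`. -/
def lastVisit (w : List (MStep X)) : ℕ :=
  sSup {n : ℕ | n < w.length ∧ height (w.take n) = 0}

/-- The product of Motzkin paths. For the decompositions `m = m₁ ∘ ⋯ ∘ mₚ` and
`m' = m'₁ ∘ ⋯ ∘ m'_q` into indecomposable paths, `m.drop (lastVisit m)` is `mₚ` and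
`m'.take (firstReturn m')` is `m'₁`. If both begin with an up step, they are the raised paths of
`r.dropLast` and `r'.dropLast`, and `mₚ`, `m'₁` are multiplied by the Rota-Baxter relation;
in all other cases (one of them is a level step, or `m` or `m'` is trivial) the product is the
link product. -/
def diamond {k : Type v} [CommRing k] (lam : k) (m m' : List (MStep X)) :
    List (MStep X) →₀ k :=
  match _hp : m.drop (lastVisit m), _hq : m'.take (firstReturn m') with
  | .up :: r, .up :: r' =>
      Finsupp.mapDomain
        (fun c => link (m.take (lastVisit m)) (link (raise c) (m'.drop (firstReturn m'))))
        (diamond lam r.dropLast (.up :: r') + diamond lam (.up :: r) r'.dropLast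
          + lam • diamond lam r.dropLast r'.dropLast)
  | _, _ => Finsupp.single (link m m') 1
termination_by m.length + m'.length
decreasing_by
  all_goals
    have h1 := congrArg List.length _hp
    have h2 := congrArg List.length _hq
    simp only [List.length_drop, List.length_take, List.length_cons, List.length_dropLast]
      at h1 h2 ⊢
    omega

end Motzkin

/-! ### Leaf decorated planar rooted forests -/

mutual

/-- Planar rooted trees with leaves decorated by `X`: a leaf, or the grafting of a forest. -/
inductive LTree (X : Type u) : Type u where
  | leaf (x : X) : LTree X
  | graft (F : LForest X) : LTree X

/-- Planar rooted forests with leaves decorated by `X`: nonempty sequences of trees. -/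
inductive LForest (X : Type u) : Type u where
  | single (T : LTree X) : LForest X
  | cons (T : LTree X) (F : LForest X) : LForest X

end

/-- The tree is not a single leaf. -/
def LTree.IsNonLeaf {X : Type u} : LTree X → Prop
  | .leaf _ => False
  | .graft _ => True

namespace LForest

variable {X : Type u}

/-- The leftmost tree. -/
def first : LForest X → LTree X
  | .single T => T
  | .cons T _ => T

/-- The rightmost tree. -/
def last : LForest X → LTree X
  | .single T => T
  | .cons _ F => last F

/-- Concatenation of forests. -/
def append : LForest X → LForest X → LForest X
  | .single T, G => .cons T G
  | .cons T F, G => .cons T (append F G)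

/-- The grafting operator on forests. -/
def grafting (F : LForest X) : LForest X := .single (.graft F)

/-- The product of leaf decorated forests, obtained by multiplying the last tree of the first
forest with the first tree of the second one. -/
def diamond {k : Type v} [CommRing k] (lam : k) : LForest X → LForest X → (LForest X →₀ k)
  | .cons T F, G => Finsupp.mapDomain (fun H => .cons T H) (diamond lam F G)
  | .single T, .cons T' G =>
      Finsupp.mapDomain (fun H => append H G) (diamond lam (.single T) (.single T'))
  | .single (.leaf x), .single T' => Finsupp.single (.cons (.leaf x) (.single T')) 1
  | .single (.graft F), .single (.leaf x') =>
      Finsupp.single (.cons (.graft F) (.single (.leaf x'))) 1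
  | .single (.graft F), .single (.graft F') =>
      Finsupp.mapDomain grafting
        (diamond lam F (.single (.graft F')) + diamond lam (.single (.graft F)) F'
          + lam • diamond lam F F')
termination_by F G => sizeOf F + sizeOf G
decreasing_by
  · simp
  · have hG : 0 < sizeOf G := by cases G <;> simp
    simp
    omega
  all_goals
    simp
    try omega

end LForest

mutual

/-- No vertex of the tree has two adjacent non-leaf branches. -/
def LTree.LeafSpaced {X : Type u} : LTree X → Prop
  | .leaf _ => True
  | .graft F => LForest.LeafSpaced F

/-- No vertex of the forest has two adjacent non-leaf branches, and no two adjacent trees of the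
forest are both non-leaf (so that grafting the forest does not create such a vertex). -/
def LForest.LeafSpaced {X : Type u} : LForest X → Prop
  | .single T => LTree.LeafSpaced T
  | .cons T F => LTree.LeafSpaced T ∧ LForest.LeafSpaced F ∧
      ¬ (T.IsNonLeaf ∧ F.first.IsNonLeaf)

end

/-! ### Helper facts: closure of the products -/

theorem mapDomain_mem_supported' {k : Type v} [CommRing k] {B : Type u} {C : Type w} (g : B → C)
    {S : Set B} {T : Set C} (h : ∀ b ∈ S, g b ∈ T) {a : B →₀ k}
    (ha : a ∈ Finsupp.supported k k S) :
    Finsupp.mapDomain g a ∈ Finsupp.supported k k T := by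
  classical
  rw [Finsupp.mem_supported] at ha ⊢
  intro c hc
  have := Finsupp.mapDomain_support hc
  simp only [Finset.mem_image] at this
  obtain ⟨b, hb, rfl⟩ := this
  exact h b (ha hb)

namespace Motzkin

variable {X : Type u}

theorem height_append (u w : List (MStep X)) : height (u ++ w) = height u + height w := by
  simp [height]

theorem height_cons (s : MStep X) (w : List (MStep X)) :
    height (s :: w) = rise s + height w := by
  simp [height]

@[simp] theorem height_nil : height ([] : List (MStep X)) = 0 := rfl

theorem isMotzkin_link {u w : List (MStep X)} (hu : IsMotzkin u) (hw : IsMotzkin w) :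
    IsMotzkin (link u w) := by
  refine ⟨fun n => ?_, ?_⟩
  · rw [link, List.take_append, height_append]
    exact add_nonneg (hu.1 _) (hw.1 _)
  · rw [link, height_append, hu.2, hw.2, add_zero]

theorem isMotzkin_raise {m : List (MStep X)} (hm : IsMotzkin m) : IsMotzkin (raise m) := by
  refine ⟨fun n => ?_, ?_⟩
  · cases n with
    | zero => simp
    | succ n =>
      rw [raise, List.take_succ_cons, height_cons, List.take_append, height_append]
      have h1 := hm.1 n
      have h2 : -1 ≤ height (([MStep.down] : List (MStep X)).take (n - m.length)) := by
        cases n - m.length <;> simp [height, rise]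
      simp only [rise]
      omega
  · rw [raise, height_cons, height_append, hm.2]
    simp [height, rise]

theorem isMotzkin_take {m : List (MStep X)} (hm : IsMotzkin m) {n : ℕ}
    (hn : height (m.take n) = 0) : IsMotzkin (m.take n) := by
  refine ⟨fun j => ?_, hn⟩
  rw [List.take_take]
  exact hm.1 _

theorem height_take_drop (m : List (MStep X)) (n j : ℕ) :
    height (m.take (n + j)) = height (m.take n) + height ((m.drop n).take j) := by
  rw [List.take_add, height_append]

theorem isMotzkin_drop {m : List (MStep X)} (hm : IsMotzkin m) {n : ℕ}
    (hn : height (m.take n) = 0) : IsMotzkin (m.drop n) := by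
  refine ⟨fun j => ?_, ?_⟩
  · have h1 := height_take_drop m n j
    have h2 := hm.1 (n + j)
    omega
  · have h1 := height_append (m.take n) (m.drop n)
    rw [List.take_append_drop, hm.2, hn] at h1
    omega

/-- A path that starts with an up step and touches the axis only at its ends is raised. -/
theorem prime_eq_raise {r : List (MStep X)} (hm : IsMotzkin (.up :: r))
    (hp : ∀ j, 0 < j → j < (MStep.up :: r).length → height ((MStep.up :: r).take j) ≠ 0) :
    .up :: r = raise r.dropLast ∧ IsMotzkin r.dropLast := by
  rcases List.eq_nil_or_concat r with rfl | ⟨q, s, rfl⟩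
  · have := hm.2
    simp [height, rise] at this
  · simp only [List.concat_eq_append, List.dropLast_concat] at *
    have hq : ∀ j, j ≤ q.length → 0 ≤ height (q.take j) := by
      intro j hj
      have h1 := hm.1 (j + 1)
      have h2 := hp (j + 1) (by omega) (by simp; omega)
      rw [List.take_succ_cons, height_cons, List.take_append_of_le_length hj] at h1 h2
      simp only [rise] at h1 h2
      omega
    have h0 := hm.2
    rw [height_cons, height_append, height_cons] at h0
    have h1 := hq q.length le_rfl
    rw [List.take_length] at h1
    have hs : s = .down ∧ height q = 0 := by
      cases s <;> simp [rise] at h0 ⊢ <;> omega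
    refine ⟨by rw [hs.1]; rfl, fun j => ?_, hs.2⟩
    rcases le_total j q.length with hj | hj
    · exact hq j hj
    · rw [List.take_of_length_le hj, hs.2]

theorem firstReturn_spec {m : List (MStep X)} (hm : IsMotzkin m) (h0 : m ≠ []) :
    0 < firstReturn m ∧ height (m.take (firstReturn m)) = 0 ∧
      ∀ j, 0 < j → j < firstReturn m → height (m.take j) ≠ 0 := by
  have hne : {n : ℕ | 0 < n ∧ height (m.take n) = 0}.Nonempty :=
    ⟨m.length, List.length_pos_iff.2 h0, by rw [List.take_length]; exact hm.2⟩
  have hmem := Nat.sInf_mem hne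
  exact ⟨hmem.1, hmem.2, fun j hj hlt h => Nat.notMem_of_lt_sInf hlt ⟨hj, h⟩⟩

theorem lastVisit_spec {m : List (MStep X)} (h0 : m ≠ []) :
    lastVisit m < m.length ∧ height (m.take (lastVisit m)) = 0 ∧
      ∀ j, lastVisit m < j → j < m.length → height (m.take j) ≠ 0 := by
  have hne : {n : ℕ | n < m.length ∧ height (m.take n) = 0}.Nonempty :=
    ⟨0, List.length_pos_iff.2 h0, by simp⟩
  have hb : BddAbove {n : ℕ | n < m.length ∧ height (m.take n) = 0} :=
    ⟨m.length, fun n hn => hn.1.le⟩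
  have hmem := Nat.sSup_mem hne hb
  exact ⟨hmem.1, hmem.2, fun j hlt hj h => absurd (le_csSup hb ⟨hj, h⟩) (not_le.2 hlt)⟩

theorem head?_ne_down {m : List (MStep X)} (hm : IsMotzkin m) : m.head? ≠ some .down := by
  intro h
  cases m with
  | nil => simp at h
  | cons s r =>
    simp only [List.head?_cons, Option.some.injEq] at h
    subst h
    have := hm.1 1
    simp [height, rise] at this

theorem getLast?_ne_up {m : List (MStep X)} (hm : IsMotzkin m) : m.getLast? ≠ some .up := by
  intro h
  rcases List.eq_nil_or_concat m with rfl | ⟨q, s, rfl⟩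
  · simp at h
  · simp only [List.concat_eq_append, List.getLast?_concat, Option.some.injEq] at *
    subst h
    have h1 := hm.1 q.length
    have h2 := hm.2
    rw [List.take_left'] at h1
    · rw [height_append] at h2
      simp [height, rise] at h1 h2
      omega
    · rfl

/-- The peak-free and valley-free Motzkin paths. -/
def PeakValleyFree (X : Type u) : Set (List (MStep X)) :=
  {w | IsMotzkin w ∧ PeakFree w ∧ ValleyFree w}

theorem peakFree_link {u w : List (MStep X)} (hu : IsMotzkin u) (hu' : PeakFree u)
    (hw' : PeakFree w) : PeakFree (link u w) := by
  refine ⟨by simp [link, hu'.1], List.isChain_append.2 ⟨hu'.2, hw'.2, ?_⟩⟩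
  rintro x hx y - ⟨rfl, -⟩
  exact getLast?_ne_up hu hx

theorem peakFree_raise {m : List (MStep X)} (hm : IsMotzkin m) (hm' : PeakFree m) :
    PeakFree (raise m) := by
  refine ⟨by simp [raise], ?_⟩
  rw [raise, List.isChain_cons, List.isChain_append]
  refine ⟨?_, hm'.2, by simp, ?_⟩
  · rintro y hy ⟨-, rfl⟩
    rw [List.head?_append_of_ne_nil _ hm'.1] at hy
    exact head?_ne_down hm hy
  · rintro x hx y - ⟨rfl, -⟩
    exact getLast?_ne_up hm hx

theorem raise_mem {m : List (MStep X)} (hm : m ∈ PeakValleyFree X) :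
    raise m ∈ PeakValleyFree X := by
  refine ⟨isMotzkin_raise hm.1, peakFree_raise hm.1 hm.2.1, ?_⟩
  rw [ValleyFree, raise, List.isChain_cons, List.isChain_append]
  refine ⟨by simp, hm.2.2, by simp, by simp⟩

theorem lastPart_spec {m r : List (MStep X)} (hm : m ∈ PeakValleyFree X)
    (hr : m.drop (lastVisit m) = .up :: r) :
    MStep.up :: r ∈ PeakValleyFree X ∧ r.dropLast ∈ PeakValleyFree X ∧
      IsMotzkin (m.take (lastVisit m)) ∧ (m.take (lastVisit m)).getLast? ≠ some .down := by
  obtain ⟨h1, h2, h3⟩ := lastVisit_spec hm.2.1.1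
  have hM := isMotzkin_drop hm.1 h2
  have hprime := prime_eq_raise (hr ▸ hM) (by
    intro j hj hlt
    rw [← hr] at hlt ⊢
    have := height_take_drop m (lastVisit m) j
    have h4 := h3 (lastVisit m + j) (by omega) (by simp at hlt; omega)
    omega)
  have hpk := hm.2.1.2
  have hva := hm.2.2
  rw [ValleyFree] at hva
  rw [← List.take_append_drop (lastVisit m) m, List.isChain_append, hr] at hpk hva
  have hqne : r.dropLast ≠ [] := by
    intro h
    have h5 := hpk.2.1
    rw [hprime.1, h] at h5
    simp [raise] at h5
  refine ⟨⟨hr ▸ hM, ⟨by simp, hpk.2.1⟩, hva.2.1⟩, ⟨hprime.2, ⟨hqne, ?_⟩, ?_⟩,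
    isMotzkin_take hm.1 h2, ?_⟩
  · have h5 := hpk.2.1
    rw [hprime.1, raise, List.isChain_cons, List.isChain_append] at h5
    exact h5.2.1
  · have h5 := hva.2.1
    rw [hprime.1, raise, List.isChain_cons, List.isChain_append] at h5
    exact h5.2.1
  · intro h
    exact hva.2.2 _ h _ (by simp) ⟨rfl, rfl⟩

theorem firstPart_spec {m r : List (MStep X)} (hm : m ∈ PeakValleyFree X)
    (hr : m.take (firstReturn m) = .up :: r) :
    MStep.up :: r ∈ PeakValleyFree X ∧ r.dropLast ∈ PeakValleyFree X ∧
      IsMotzkin (m.drop (firstReturn m)) ∧ (m.drop (firstReturn m)).head? ≠ some .up := by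
  obtain ⟨h1, h2, h3⟩ := firstReturn_spec hm.1 hm.2.1.1
  have hM := isMotzkin_take hm.1 h2
  have hprime := prime_eq_raise (hr ▸ hM) (by
    intro j hj hlt
    rw [← hr] at hlt ⊢
    simp only [List.length_take] at hlt
    rw [List.take_take, min_eq_left (by omega)]
    exact h3 j hj (by omega))
  have hpk := hm.2.1.2
  have hva := hm.2.2
  rw [ValleyFree] at hva
  rw [← List.take_append_drop (firstReturn m) m, List.isChain_append, hr] at hpk hva
  have hqne : r.dropLast ≠ [] := by
    intro h
    have h5 := hpk.1
    rw [hprime.1, h] at h5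
    simp [raise] at h5
  refine ⟨⟨hr ▸ hM, ⟨by simp, hpk.1⟩, hva.1⟩, ⟨hprime.2, ⟨hqne, ?_⟩, ?_⟩,
    isMotzkin_drop hm.1 h2, ?_⟩
  · have h5 := hpk.1
    rw [hprime.1, raise, List.isChain_cons, List.isChain_append] at h5
    exact h5.2.1
  · have h5 := hva.1
    rw [hprime.1, raise, List.isChain_cons, List.isChain_append] at h5
    exact h5.2.1
  · intro h
    refine hva.2.2 .down ?_ _ h ⟨rfl, rfl⟩
    rw [hprime.1, raise, ← List.cons_append, List.getLast?_concat]
    rfl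

theorem lastPart_up {m : List (MStep X)} (hm : IsMotzkin m) (h : m.getLast? = some .down) :
    ∃ r, m.drop (lastVisit m) = .up :: r := by
  have hne : m ≠ [] := by rintro rfl; simp at h
  obtain ⟨h1, h2, h3⟩ := lastVisit_spec hne
  have hM := isMotzkin_drop hm h2
  have hl : (m.drop (lastVisit m)).getLast? = some .down := by
    rw [List.getLast?_drop, if_neg (by omega), h]
  rcases hd : m.drop (lastVisit m) with _ | ⟨s, r⟩
  · simp [hd] at hl
  · cases s with
    | up => exact ⟨r, rfl⟩
    | down => exact absurd (by rw [hd]; rfl) (head?_ne_down hM)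
    | level x =>
      exfalso
      have hlen := congrArg List.length hd
      simp only [List.length_drop, List.length_cons] at hlen
      have h4 := height_take_drop m (lastVisit m) 1
      rw [hd, h2] at h4
      simp [height, rise] at h4
      by_cases hr : r = []
      · subst hr
        rw [hd] at hl
        simp at hl
      · have := List.length_pos_iff.2 hr
        exact h3 (lastVisit m + 1) (by omega) (by omega) (by simpa [height] using h4)

theorem firstPart_up {m : List (MStep X)} (hm : IsMotzkin m) (h : m.head? = some .up) :
    ∃ r, m.take (firstReturn m) = .up :: r := by
  have hne : m ≠ [] := by rintro rfl; simp at h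
  obtain ⟨h1, -, -⟩ := firstReturn_spec hm hne
  obtain ⟨n, hn⟩ := Nat.exists_eq_succ_of_ne_zero h1.ne'
  cases m with
  | nil => simp at h
  | cons s r =>
    simp only [List.head?_cons, Option.some.injEq] at h
    subst h
    exact ⟨r.take n, by rw [hn, List.take_succ_cons]⟩

theorem link_raise_link_mem {a c b : List (MStep X)} (hc : c ∈ PeakValleyFree X)
    (ha : IsMotzkin a) (hb : IsMotzkin b)
    (ha' : a.IsChain fun s t => ¬ (s = MStep.up ∧ t = .down)) (ha'' : ValleyFree a)
    (hb' : b.IsChain fun s t => ¬ (s = MStep.up ∧ t = .down)) (hb'' : ValleyFree b)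
    (hau : a.getLast? ≠ some .down) (hbu : b.head? ≠ some .up) :
    link a (link (raise c) b) ∈ PeakValleyFree X := by
  have hr := raise_mem hc
  have hlast : (raise c).getLast? = some .down := by
    rw [raise, ← List.cons_append, List.getLast?_concat]
  refine ⟨isMotzkin_link ha (isMotzkin_link hr.1 hb), ⟨by simp [link, raise], ?_⟩, ?_⟩
  · rw [link, link, List.isChain_append, List.isChain_append]
    refine ⟨ha', ⟨hr.2.1.2, hb', ?_⟩, ?_⟩
    · rintro x hx y - ⟨rfl, -⟩
      exact getLast?_ne_up hr.1 hx
    · rintro x hx y - ⟨rfl, -⟩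
      exact getLast?_ne_up ha hx
  · rw [ValleyFree, link, link, List.isChain_append, List.isChain_append]
    refine ⟨ha'', ⟨hr.2.2, hb'', ?_⟩, ?_⟩
    · rintro x - y hy ⟨-, rfl⟩
      exact hbu hy
    · rintro x hx y - ⟨rfl, -⟩
      exact hau hx

theorem diamond_mem {k : Type v} [CommRing k] (lam : k) (m m' : List (MStep X))
    (hm : m ∈ PeakValleyFree X) (hm' : m' ∈ PeakValleyFree X) :
    diamond lam m m' ∈ Finsupp.supported k k (PeakValleyFree X) := by
  fun_induction diamond lam m m' with
  | case1 m m' r r' hp hq ih1 ih2 ih3 =>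
    obtain ⟨p1, p2, p3, p4⟩ := lastPart_spec hm hp
    obtain ⟨q1, q2, q3, q4⟩ := firstPart_spec hm' hq
    have e1 := hm.2.1.2
    have e2 := hm.2.2
    have e3 := hm'.2.1.2
    have e4 := hm'.2.2
    rw [ValleyFree] at e2 e4
    rw [← List.take_append_drop (lastVisit m) m, List.isChain_append] at e1 e2
    rw [← List.take_append_drop (firstReturn m') m', List.isChain_append] at e3 e4
    refine mapDomain_mem_supported' _ (S := PeakValleyFree X) (fun c hc => ?_) ?_
    · exact link_raise_link_mem hc p3 q3 e1.1 e2.1 e3.2.1 e4.2.1 p4 q4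
    · exact add_mem (add_mem (ih1 p2 q1) (ih2 p1 q2)) (Submodule.smul_mem _ _ (ih3 p2 q2))
  | case2 m m' hno =>
    refine Finsupp.single_mem_supported k _ ⟨isMotzkin_link hm.1 hm'.1,
      peakFree_link hm.1 hm.2.1 hm'.2.1, ?_⟩
    rw [ValleyFree, link, List.isChain_append]
    refine ⟨hm.2.2, hm'.2.2, ?_⟩
    rintro x hx y hy ⟨rfl, rfl⟩
    obtain ⟨r, hr⟩ := lastPart_up hm.1 hx
    obtain ⟨r', hr'⟩ := firstPart_up hm'.1 hy
    exact hno r r' hr hr'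

end Motzkin

namespace LForest

variable {X : Type u}

@[simp] theorem first_append (F G : LForest X) : (append F G).first = F.first := by
  cases F <;> rfl

theorem last_append (F G : LForest X) : (append F G).last = G.last := by
  match F with
  | .single T => rfl
  | .cons T F => exact last_append F G

theorem leafSpaced_append (F G : LForest X) (hF : LeafSpaced F) (hG : LeafSpaced G)
    (h : ¬ (F.last.IsNonLeaf ∧ G.first.IsNonLeaf)) : LeafSpaced (append F G) := by
  match F with
  | .single T =>
    rw [LeafSpaced] at hF
    rw [append, LeafSpaced]
    exact ⟨hF, hG, h⟩
  | .cons T F =>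
    rw [LeafSpaced] at hF
    rw [append, LeafSpaced, first_append]
    exact ⟨hF.1, leafSpaced_append F G hF.2.1 hG h, hF.2.2⟩

theorem diamond_mem_aux {k : Type v} [CommRing k] (lam : k) (F G : LForest X)
    (hF : LeafSpaced F) (hG : LeafSpaced G) :
    diamond lam F G ∈ Finsupp.supported k k {H | LeafSpaced H ∧
      (H.first.IsNonLeaf ↔ F.first.IsNonLeaf) ∧ (H.last.IsNonLeaf ↔ G.last.IsNonLeaf)} := by
  fun_induction diamond lam F G with
  | case1 T F G ih =>
    rw [LeafSpaced] at hF
    refine mapDomain_mem_supported' _ (fun H hH => ?_) (ih hF.2.1 hG)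
    obtain ⟨h1, h2, h3⟩ := hH
    refine ⟨?_, Iff.rfl, h3⟩
    rw [LeafSpaced]
    exact ⟨hF.1, h1, by rw [h2]; exact hF.2.2⟩
  | case2 T T' G ih =>
    rw [LeafSpaced] at hG
    refine mapDomain_mem_supported' _ (fun H hH => ?_) (ih hF (by rw [LeafSpaced]; exact hG.1))
    obtain ⟨h1, h2, h3⟩ := hH
    refine ⟨leafSpaced_append _ _ h1 hG.2.1 (by rw [h3]; exact hG.2.2), ?_, ?_⟩
    · rw [first_append]; exact h2
    · rw [last_append]; rfl
  | case3 x T' =>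
    refine Finsupp.single_mem_supported k _ ⟨?_, Iff.rfl, Iff.rfl⟩
    rw [LeafSpaced]
    rw [LeafSpaced] at hF
    exact ⟨hF, hG, fun h => h.1⟩
  | case4 F x =>
    refine Finsupp.single_mem_supported k _ ⟨?_, Iff.rfl, Iff.rfl⟩
    rw [LeafSpaced]
    rw [LeafSpaced] at hF
    exact ⟨hF, hG, fun h => h.2⟩
  | case5 F F' ih1 ih2 ih3 =>
    have hF' : LeafSpaced F := by rw [LeafSpaced, LTree.LeafSpaced] at hF; exact hF
    have hG' : LeafSpaced F' := by rw [LeafSpaced, LTree.LeafSpaced] at hG; exact hG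
    have key : ∀ a : LForest X →₀ k, a ∈ Finsupp.supported k k {H | LeafSpaced H} →
        Finsupp.mapDomain grafting a ∈ Finsupp.supported k k {H | LeafSpaced H ∧
          (H.first.IsNonLeaf ↔ (LForest.single (LTree.graft F)).first.IsNonLeaf) ∧
          (H.last.IsNonLeaf ↔ (LForest.single (LTree.graft F')).last.IsNonLeaf)} := by
      intro a ha
      refine mapDomain_mem_supported' _ (fun H hH => ?_) ha
      refine ⟨?_, Iff.rfl, Iff.rfl⟩
      rw [grafting, LeafSpaced, LTree.LeafSpaced]
      exact hH
    have mono : ∀ {S : LForest X → Prop} {a : LForest X →₀ k},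
        a ∈ Finsupp.supported k k {H | LeafSpaced H ∧ S H} →
        a ∈ Finsupp.supported k k {H | LeafSpaced H} :=
      fun h => Finsupp.supported_mono (fun _ hH => hH.1) h
    exact key _ (add_mem (add_mem (mono (ih1 hF' hG)) (mono (ih2 hF hG')))
      (Submodule.smul_mem _ _ (mono (ih3 hF' hG'))))

theorem diamond_mem {k : Type v} [CommRing k] (lam : k) (F G : LForest X)
    (hF : LeafSpaced F) (hG : LeafSpaced G) :
    diamond lam F G ∈ Finsupp.supported k k {H : LForest X | LeafSpaced H} :=
  Finsupp.supported_mono (fun _ hH => hH.1) (diamond_mem_aux lam F G hF hG)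

end LForest

/-! ### The two algebras -/

/-- `(A, P)` together with `j : X → A` is the free nonunitary Rota-Baxter `k`-algebra of
weight `lam` on `X`. -/
def IsFreeNonunitaryRotaBaxterAlgebra {k : Type v} [CommRing k] (lam : k) {X : Type u}
    {A : Type w} [NonUnitalNonAssocRing A] [Module k A] (P : A →ₗ[k] A) (j : X → A) : Prop :=
  IsNonunitaryRotaBaxterAlgebra lam P ∧
    ∀ (R : Type t) [NonUnitalRing R] [Module k R] [IsScalarTower k R R] [SMulCommClass k R R]
      (Q : R →ₗ[k] R), RotaBaxterIdentity lam Q →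
      ∀ f : X → R, ∃! g : A →ₙₐ[k] R, (∀ a, g (P a) = Q (g a)) ∧ ∀ x, g (j x) = f x

namespace Motzkin

variable {X : Type u}

/-- The peak-free Motzkin paths. -/
def PeakFreePath (X : Type u) : Type u := {w : List (MStep X) // IsMotzkin w ∧ PeakFree w}

/-- The peak-free and valley-free Motzkin paths. -/
abbrev LVPath (X : Type u) : Type u := PeakValleyFree X

namespace PeakFreePath

/-- The link product of peak-free paths. -/
def link (m m' : PeakFreePath X) : PeakFreePath X :=
  ⟨Motzkin.link m.1 m'.1, isMotzkin_link m.2.1 m'.2.1, peakFree_link m.2.1 m.2.2 m'.2.2⟩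

/-- The raising operator on peak-free paths. -/
def raise (m : PeakFreePath X) : PeakFreePath X :=
  ⟨Motzkin.raise m.1, isMotzkin_raise m.2.1, peakFree_raise m.2.1 m.2.2⟩

/-- The path with one level step, decorated by `x`. -/
def level (x : X) : PeakFreePath X :=
  ⟨[.level x], ⟨fun n => by cases n <;> simp [height, rise], by simp [height, rise]⟩,
    by simp, by simp⟩

end PeakFreePath

namespace LVPath

/-- A peak-free and valley-free path is in particular peak-free. -/
def toPeakFree (m : LVPath X) : PeakFreePath X := ⟨m.1, m.2.1, m.2.2.1⟩

/-- The raising operator on peak-free and valley-free paths. -/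
def raise (m : LVPath X) : LVPath X := ⟨Motzkin.raise m.1, raise_mem m.2⟩

/-- The product of peak-free and valley-free paths, a linear combination of such paths. -/
def diamond {k : Type v} [CommRing k] (lam : k) (m m' : LVPath X) : LVPath X →₀ k :=
  Finsupp.supportedEquivFinsupp (PeakValleyFree X)
    ⟨Motzkin.diamond lam m.1 m'.1, diamond_mem lam m.1 m'.1 m.2 m'.2⟩

end LVPath

end Motzkin

/-- The leaf-spaced leaf decorated forests. -/
abbrev LSForest (X : Type u) : Type u := {F : LForest X | F.LeafSpaced}

namespace LSForest

variable {X : Type u}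

/-- The forest with one vertex, decorated by `x`. -/
def leaf (x : X) : LSForest X :=
  ⟨.single (.leaf x), by simp [LForest.LeafSpaced, LTree.LeafSpaced]⟩

/-- The grafting operator on leaf-spaced forests. -/
def grafting (F : LSForest X) : LSForest X :=
  ⟨F.1.grafting, by
    have h : F.1.LeafSpaced := F.2
    change (LForest.single (LTree.graft F.1)).LeafSpaced
    rw [LForest.LeafSpaced, LTree.LeafSpaced]
    exact h⟩

/-- The product of leaf-spaced forests, a linear combination of such forests. -/
def diamond {k : Type v} [CommRing k] (lam : k) (F G : LSForest X) : LSForest X →₀ k :=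
  Finsupp.supportedEquivFinsupp {F : LForest X | F.LeafSpaced}
    ⟨LForest.diamond lam F.1 G.1, LForest.diamond_mem lam F.1 G.1 F.2 G.2⟩

end LSForest

/-- The free `k`-module on the peak-free and valley-free Motzkin paths, with its product of
weight `lam`. -/
abbrev MotzkinAlgebra {k : Type v} [CommRing k] (lam : k) (X : Type u) : Type (max u v) :=
  BasisAlgebra (Motzkin.LVPath.diamond lam (X := X))

/-- The raising operator, extended linearly. -/
def MotzkinAlgebra.raising {k : Type v} [CommRing k] (lam : k) (X : Type u) :
    MotzkinAlgebra lam X →ₗ[k] MotzkinAlgebra lam X :=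
  BasisAlgebra.mapBasis _ Motzkin.LVPath.raise

/-- The free `k`-module on the leaf-spaced leaf decorated forests, with its product of
weight `lam`. -/
abbrev LeafAlgebra {k : Type v} [CommRing k] (lam : k) (X : Type u) : Type (max u v) :=
  BasisAlgebra (LSForest.diamond lam (X := X))

/-- The grafting operator, extended linearly. -/
def LeafAlgebra.grafting {k : Type v} [CommRing k] (lam : k) (X : Type u) :
    LeafAlgebra lam X →ₗ[k] LeafAlgebra lam X :=
  BasisAlgebra.mapBasis _ LSForest.grafting

/-- `φ` is a morphism of operated semigroups from the peak-free Motzkin paths to the leaf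
decorated forests that sends a level step decorated by `x` to the one-vertex tree
decorated by `x`. -/
structure IsPathToForest {X : Type u} (φ : Motzkin.PeakFreePath X → LForest X) : Prop where
  map_link : ∀ m m', φ (m.link m') = (φ m).append (φ m')
  map_raise : ∀ m, φ m.raise = (φ m).grafting
  map_level : ∀ x, φ (.level x) = .single (.leaf x)

end

/-!
The argument passes through the algebra of *all* leaf decorated forests (`ForestAlgebra`), with
the product `LForest.diamond`.

Concatenation of forests, extended bilinearly, satisfies `(a ⬝ b) * c = a ⬝ (b * c)` and
`a * (b ⬝ c) = (a * b) ⬝ c` (`conc_mul`, `mul_conc`), because the product only involves the last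
tree of the left factor and the first tree of the right one. This reduces associativity to three
trees. If one of them is a leaf, all products with it are concatenations; if all three are grafted,
both sides are expanded by the Rota-Baxter identity and compared by induction on the total size
(`RotaBaxterIdentity.mul_assoc`, `basis_mul_assoc`). The leaf-spaced forests span a subalgebra
stable under grafting, so they form a Rota-Baxter algebra as well.

For freeness, a map `f : X → R` is extended to all forests by evaluating leaves with `f`, grafting
with `Q` and concatenation with the product of `R`. This evaluation is multiplicative for
`LForest.diamond` (`LForest.linearCombination_eval_diamond`), since the recursion defining the
product consists of identities valid in `R`. It is the only possible morphism on leaf-spaced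
forests because there concatenation *is* the product: of two adjacent trees, one is a leaf
(`LeafAlgebra.of_single_mul_of`, `LeafAlgebra.apply_of_eq`).

For paths, a forest is sent to the Motzkin path that reads it (`LForest.word`). The words of trees
form a prefix code, which gives injectivity; cutting a path at its first return to the axis
gives surjectivity onto the peak-free paths. Hence `φ` is the inverse of this bijection, and
valley-free paths correspond to leaf-spaced forests (`LForest.valleyFree_word`). The product of
paths satisfies the recursion of the product of forests (`Motzkin.diamond_word`), so the bijection
of bases is an isomorphism of algebras.
-/

noncomputable section

/-! ### Free modules with a multiplication given on the basis -/

namespace BasisAlgebra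

variable {k : Type v} [CommRing k] {B : Type u} (μ : B → B → (B →₀ k))

instance : IsScalarTower k (BasisAlgebra μ) (BasisAlgebra μ) where
  smul_assoc c x y := LinearMap.map_smul₂ (mulBilin μ) c x y

instance : SMulCommClass k (BasisAlgebra μ) (BasisAlgebra μ) where
  smul_comm c x y := ((mulBilin μ x).map_smul c y).symm

variable {μ}

theorem of_mul_of (b c : B) : of μ b * of μ c = (μ b c : B →₀ k) := by
  change mulBilin μ (Finsupp.single b 1) (Finsupp.single c 1) = _
  simp [mulBilin]

@[simp] theorem mapBasis_of (g : B → B) (b : B) : mapBasis μ g (of μ b) = of μ (g b) :=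
  Finsupp.mapDomain_single

theorem induction {p : BasisAlgebra μ → Prop} (a : BasisAlgebra μ)
    (zero : p 0) (add : ∀ a b, p a → p b → p (a + b)) (smul : ∀ (c : k) a, p a → p (c • a))
    (basis : ∀ b, p (of μ b)) : p a := by
  refine Finsupp.induction_linear (motive := p) a zero (fun a b => add a b) fun b c => ?_
  have h := smul c _ (basis b)
  have e : c • of μ b = (Finsupp.single b c : B →₀ k) := by
    change c • (Finsupp.single b (1 : k) : B →₀ k) = _
    simp
  rwa [e] at h

theorem hom_ext {R : Type w} [NonUnitalNonAssocRing R] [Module k R]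
    {f g : BasisAlgebra μ →ₙₐ[k] R} (h : ∀ b, f (of μ b) = g (of μ b)) : f = g := by
  ext a
  induction a using induction with
  | zero => simp
  | add a b ha hb => simp [ha, hb]
  | smul c a ha => simp [ha]
  | basis b => exact h b

section Lift

variable {R : Type w} [NonUnitalNonAssocRing R] [Module k R] [IsScalarTower k R R]
  [SMulCommClass k R R]

/-- The algebra homomorphism extending a map on the basis that is multiplicative on pairs of
basis elements. -/
def lift (g : B → R) (h : ∀ b c, Finsupp.linearCombination k g (μ b c) = g b * g c) :
    BasisAlgebra μ →ₙₐ[k] R where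
  toFun := (Finsupp.linearCombination k g : (B →₀ k) →ₗ[k] R)
  map_smul' := (Finsupp.linearCombination k g).map_smul
  map_zero' := (Finsupp.linearCombination k g).map_zero
  map_add' := (Finsupp.linearCombination k g).map_add
  map_mul' a b := by
    have of_eq : ∀ b : B, (Finsupp.linearCombination k g : (B →₀ k) →ₗ[k] R) (of μ b) = g b :=
      fun b => by
        change (Finsupp.linearCombination k g) (Finsupp.single b (1 : k)) = _
        simp
    let L : BasisAlgebra μ →ₗ[k] R := (Finsupp.linearCombination k g : (B →₀ k) →ₗ[k] R)
    change L (a * b) = L a * L b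
    induction a using induction with
    | zero => simp
    | add a a' ha ha' => rw [add_mul, map_add, map_add, ha, ha', add_mul]
    | smul c a ha => rw [smul_mul_assoc, map_smul, map_smul, ha, smul_mul_assoc]
    | basis b' =>
      induction b using induction with
      | zero => simp
      | add a a' ha ha' => rw [mul_add, map_add, map_add, ha, ha', mul_add]
      | smul c a ha => rw [mul_smul_comm, map_smul, map_smul, ha, mul_smul_comm]
      | basis c =>
        rw [of_mul_of]
        exact (h b' c).trans (congrArg₂ (· * ·) (of_eq b').symm (of_eq c).symm)

@[simp] theorem lift_of (g : B → R)
    (h : ∀ b c, Finsupp.linearCombination k g (μ b c) = g b * g c) (b : B) :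
    lift g h (of μ b) = g b := by
  change (Finsupp.linearCombination k g) (Finsupp.single b (1 : k)) = _
  simp

end Lift

section Map

variable {C : Type w} {ν : C → C → (C →₀ k)}

theorem linearCombination_of (g : B → C) (x : B →₀ k) :
    Finsupp.linearCombination k (fun b => of ν (g b)) x = (Finsupp.mapDomain g x : C →₀ k) := by
  induction x using Finsupp.induction_linear with
  | zero => simp; rfl
  | add x y hx hy => rw [map_add, hx, hy, Finsupp.mapDomain_add]; rfl
  | single b c =>
    rw [Finsupp.linearCombination_single, Finsupp.mapDomain_single]
    change c • (Finsupp.single (g b) (1 : k) : C →₀ k) = _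
    simp

/-- The algebra homomorphism given by a map of bases that is compatible with the products of
basis elements. -/
def map (g : B → C) (h : ∀ b c, Finsupp.mapDomain g (μ b c) = ν (g b) (g c)) :
    BasisAlgebra μ →ₙₐ[k] BasisAlgebra ν :=
  lift (fun b => of ν (g b)) fun b c => by
    rw [linearCombination_of, of_mul_of, h]

variable (g : B → C) (h : ∀ b c, Finsupp.mapDomain g (μ b c) = ν (g b) (g c))

@[simp] theorem map_of (b : B) : map g h (of μ b) = of ν (g b) := lift_of _ _ b

theorem map_injective (hg : Function.Injective g) : Function.Injective (map g h) := by
  have e : ∀ a, map g h a = (Finsupp.mapDomain g a : C →₀ k) := linearCombination_of g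
  intro a b hab
  rw [e, e] at hab
  exact Finsupp.mapDomain_injective hg hab

theorem map_surjective (hg : Function.Surjective g) : Function.Surjective (map g h) := by
  have e : ∀ a, map g h a = (Finsupp.mapDomain g a : C →₀ k) := linearCombination_of g
  intro a
  obtain ⟨b, hb⟩ := Finsupp.mapDomain_surjective hg a
  exact ⟨b, (e b).trans hb⟩

theorem map_mapBasis (p : B → B) (q : C → C) (hpq : ∀ b, g (p b) = q (g b))
    (a : BasisAlgebra μ) : map g h (mapBasis μ p a) = mapBasis ν q (map g h a) := by
  induction a using induction with
  | zero => simp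
  | add a b ha hb => simp [ha, hb]
  | smul c a ha => simp [ha]
  | basis b => simp [hpq]

end Map

/-- It suffices to check the Rota-Baxter identity on basis elements. -/
theorem rotaBaxterIdentity_of_basis {lam : k} {P : BasisAlgebra μ →ₗ[k] BasisAlgebra μ}
    (h : ∀ b c, P (of μ b) * P (of μ c) =
      P (of μ b * P (of μ c)) + P (P (of μ b) * of μ c) + lam • P (of μ b * of μ c)) :
    RotaBaxterIdentity lam P := by
  intro x y
  induction x using induction with
  | zero => simp
  | add x x' hx hx' => simp only [map_add, add_mul, smul_add, hx, hx']; abel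
  | smul c x hx => simp only [map_smul, smul_mul_assoc, hx, smul_add, smul_comm c lam]
  | basis b =>
    induction y using induction with
    | zero => simp
    | add y y' hy hy' => simp only [map_add, mul_add, smul_add, hy, hy']; abel
    | smul c y hy => simp only [map_smul, mul_smul_comm, hy, smul_add, smul_comm c lam]
    | basis c => exact h b c

end BasisAlgebra

/-- A product and an operator that embed into an associative Rota-Baxter algebra make a
Rota-Baxter algebra themselves. -/
theorem IsNonunitaryRotaBaxterAlgebra.of_injective {k : Type v} [CommRing k] {lam : k}
    {A : Type u} [NonUnitalNonAssocRing A] [Module k A] [IsScalarTower k A A]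
    [SMulCommClass k A A] {A' : Type w} [NonUnitalNonAssocRing A'] [Module k A']
    {P : A →ₗ[k] A} {P' : A' →ₗ[k] A'} (h : IsNonunitaryRotaBaxterAlgebra lam P')
    (g : A →ₙₐ[k] A') (hg : Function.Injective g) (hP : ∀ a, g (P a) = P' (g a)) :
    IsNonunitaryRotaBaxterAlgebra lam P where
  smul_mul := smul_mul_assoc
  mul_smul c x y := mul_smul_comm c x y
  mul_assoc x y z := hg (by simp only [map_mul, h.mul_assoc])
  rotaBaxter x y := hg (by simp only [map_mul, map_add, map_smul, hP, h.rotaBaxter _ _])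

theorem mapDomain_val_supportedEquivFinsupp {k : Type v} [CommRing k] {B : Type u} (s : Set B)
    (a : Finsupp.supported k k s) :
    Finsupp.mapDomain Subtype.val (Finsupp.supportedEquivFinsupp s a) = (a : B →₀ k) := by
  classical
  ext b
  by_cases hb : b ∈ s
  · have := Finsupp.mapDomain_apply Subtype.val_injective (Finsupp.supportedEquivFinsupp s a)
      (⟨b, hb⟩ : s)
    exact this
  · rw [Finsupp.mapDomain_of_notMem_range _ _ (by simpa using hb)]
    by_contra hne
    exact hb (a.2 (Finsupp.mem_support_iff.2 (Ne.symm hne)))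

/-! ### The algebra of all leaf decorated forests -/

/-- The free module on all leaf decorated forests, leaf-spaced or not, with the product
`LForest.diamond`. -/
abbrev ForestAlgebra {k : Type v} [CommRing k] (lam : k) (X : Type u) : Type (max u v) :=
  BasisAlgebra (LForest.diamond lam (X := X))

namespace ForestAlgebra

open LForest BasisAlgebra

variable {k : Type v} [CommRing k] (lam : k) {X : Type u}

/-- A forest as a basis element. -/
abbrev basis (F : LForest X) : ForestAlgebra lam X := of _ F

/-- The basis element of a forest with one tree. -/
abbrev tree (T : LTree X) : ForestAlgebra lam X := basis lam (.single T)

/-- The grafting operator, extended linearly. -/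
def graft : ForestAlgebra lam X →ₗ[k] ForestAlgebra lam X := mapBasis _ LForest.grafting

/-- Concatenation of forests, extended bilinearly. -/
def conc : ForestAlgebra lam X →ₗ[k] ForestAlgebra lam X →ₗ[k] ForestAlgebra lam X :=
  (mulBilin fun F G => Finsupp.single (append F G) 1 :
    (LForest X →₀ k) →ₗ[k] (LForest X →₀ k) →ₗ[k] (LForest X →₀ k))

variable {lam}

@[simp] theorem graft_basis (F : LForest X) :
    graft lam (basis lam F) = tree lam (.graft F) := mapBasis_of _ _

theorem conc_basis (F G : LForest X) :
    conc lam (basis lam F) (basis lam G) = basis lam (append F G) := by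
  change mulBilin _ (Finsupp.single F 1) (Finsupp.single G 1) = _
  simp only [mulBilin, Finsupp.linearCombination_single, one_smul]
  rfl

theorem basis_cons (T : LTree X) (F : LForest X) :
    basis lam (.cons T F) = conc lam (tree lam T) (basis lam F) :=
  (conc_basis (.single T) F).symm

theorem _root_.LForest.append_assoc (F G H : LForest X) :
    append (append F G) H = append F (append G H) := by
  match F with
  | .single T => rfl
  | .cons T F => exact congrArg (cons T) (append_assoc F G H)

theorem conc_assoc (a b c : ForestAlgebra lam X) :
    conc lam (conc lam a b) c = conc lam a (conc lam b c) := by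
  induction a using BasisAlgebra.induction with
  | zero => simp
  | add a a' ha ha' => simp [ha, ha']
  | smul r a ha => simp [ha]
  | basis F =>
  induction b using BasisAlgebra.induction with
  | zero => simp
  | add a a' ha ha' => simp [ha, ha']
  | smul r a ha => simp [ha]
  | basis G =>
  induction c using BasisAlgebra.induction with
  | zero => simp
  | add a a' ha ha' => simp [ha, ha']
  | smul r a ha => simp [ha]
  | basis H => simp only [conc_basis, LForest.append_assoc]

theorem mapBasis_cons (T : LTree X) (a : ForestAlgebra lam X) :
    mapBasis _ (LForest.cons T) a = conc lam (tree lam T) a := by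
  induction a using BasisAlgebra.induction with
  | zero => simp
  | add a a' ha ha' => simp [ha, ha']
  | smul r a ha => simp [ha]
  | basis F => rw [mapBasis_of]; exact basis_cons T F

theorem mapBasis_append (G : LForest X) (a : ForestAlgebra lam X) :
    mapBasis _ (fun F => append F G) a = conc lam a (basis lam G) := by
  induction a using BasisAlgebra.induction with
  | zero => simp
  | add a a' ha ha' => simp [ha, ha']
  | smul r a ha => simp [ha]
  | basis F => rw [mapBasis_of]; exact (conc_basis F G).symm

theorem cons_mul (T : LTree X) (F : LForest X) (a : ForestAlgebra lam X) :
    basis lam (.cons T F) * a = conc lam (tree lam T) (basis lam F * a) := by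
  induction a using BasisAlgebra.induction with
  | zero => simp
  | add a a' ha ha' => simp [ha, ha', mul_add]
  | smul r a ha => simp [ha, mul_smul_comm]
  | basis G =>
    rw [of_mul_of, of_mul_of, LForest.diamond]
    exact mapBasis_cons T _

theorem tree_mul_cons (T S : LTree X) (G : LForest X) :
    tree lam T * basis lam (.cons S G) = conc lam (tree lam T * tree lam S) (basis lam G) := by
  rw [of_mul_of, of_mul_of, LForest.diamond]
  exact mapBasis_append G _

theorem basis_append_mul (F G : LForest X) (c : ForestAlgebra lam X) :
    basis lam (append F G) * c = conc lam (basis lam F) (basis lam G * c) := by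
  match F with
  | .single T => exact cons_mul T G c
  | .cons T F => rw [append, cons_mul, basis_append_mul F G c, basis_cons, conc_assoc]

/-- The product only involves the last tree of the left factor. -/
theorem conc_mul (a b c : ForestAlgebra lam X) : conc lam a b * c = conc lam a (b * c) := by
  induction a using BasisAlgebra.induction with
  | zero => simp
  | add a a' ha ha' => simp [ha, ha', add_mul]
  | smul r a ha => simp [ha, smul_mul_assoc]
  | basis F =>
  induction b using BasisAlgebra.induction with
  | zero => simp
  | add a a' ha ha' => simp [ha, ha', add_mul]
  | smul r a ha => simp [ha, smul_mul_assoc]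
  | basis G => rw [conc_basis, basis_append_mul]

theorem basis_mul_append (F G H : LForest X) :
    basis lam F * basis lam (append G H) = conc lam (basis lam F * basis lam G) (basis lam H) := by
  match F with
  | .cons T F => rw [cons_mul, cons_mul, basis_mul_append F G H, conc_assoc]
  | .single T =>
    match G with
    | .single S => exact tree_mul_cons T S H
    | .cons S G => rw [append, tree_mul_cons, tree_mul_cons, conc_assoc, conc_basis]

/-- The product only involves the first tree of the right factor. -/
theorem mul_conc (a b c : ForestAlgebra lam X) : a * conc lam b c = conc lam (a * b) c := by
  induction a using BasisAlgebra.induction with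
  | zero => simp
  | add a a' ha ha' => simp [ha, ha', add_mul]
  | smul r a ha => simp [ha, smul_mul_assoc]
  | basis F =>
  induction b using BasisAlgebra.induction with
  | zero => simp
  | add a a' ha ha' => simp [ha, ha', mul_add]
  | smul r a ha => simp [ha, mul_smul_comm]
  | basis G =>
  induction c using BasisAlgebra.induction with
  | zero => simp
  | add a a' ha ha' => simp [ha, ha', mul_add]
  | smul r a ha => simp [ha, mul_smul_comm]
  | basis H => rw [conc_basis, basis_mul_append]

theorem leaf_mul_basis (x : X) (F : LForest X) :
    tree lam (.leaf x) * basis lam F = conc lam (tree lam (.leaf x)) (basis lam F) := by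
  have h (T : LTree X) :
      tree lam (.leaf x) * tree lam T = basis lam (.cons (.leaf x) (.single T)) := by
    rw [of_mul_of, LForest.diamond]; rfl
  match F with
  | .single T => rw [h, basis_cons]
  | .cons T F => rw [tree_mul_cons, h, basis_cons, basis_cons, conc_assoc]

theorem leaf_mul (x : X) (a : ForestAlgebra lam X) :
    tree lam (.leaf x) * a = conc lam (tree lam (.leaf x)) a := by
  induction a using BasisAlgebra.induction with
  | zero => simp
  | add a a' ha ha' => simp [ha, ha', mul_add]
  | smul r a ha => simp [ha, mul_smul_comm]
  | basis F => exact leaf_mul_basis x F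

theorem basis_mul_leaf (F : LForest X) (x : X) :
    basis lam F * tree lam (.leaf x) = conc lam (basis lam F) (tree lam (.leaf x)) := by
  match F with
  | .single (.leaf y) => exact leaf_mul_basis y _
  | .single (.graft F) => rw [of_mul_of, LForest.diamond, conc_basis]; rfl
  | .cons T F => rw [cons_mul, basis_mul_leaf F x, basis_cons, conc_assoc]

theorem mul_leaf (a : ForestAlgebra lam X) (x : X) :
    a * tree lam (.leaf x) = conc lam a (tree lam (.leaf x)) := by
  induction a using BasisAlgebra.induction with
  | zero => simp
  | add a a' ha ha' => simp [ha, ha', add_mul]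
  | smul r a ha => simp [ha, smul_mul_assoc]
  | basis F => exact basis_mul_leaf F x

theorem rotaBaxter : RotaBaxterIdentity lam (graft lam (X := X)) := by
  refine rotaBaxterIdentity_of_basis fun F G => ?_
  rw [graft_basis, graft_basis, of_mul_of, of_mul_of, of_mul_of, of_mul_of, LForest.diamond]
  exact (map_add (graft lam) _ _).trans
    (congrArg₂ (· + ·) (map_add (graft lam) _ _) (map_smul (graft lam) _ _))

/-- If all products of `x`, `y`, `z` and their images under a Rota-Baxter operator `P`, with at
least one factor that is not such an image, are associative, then so is the product of the three
images. -/
theorem _root_.RotaBaxterIdentity.mul_assoc {A : Type w} [NonUnitalNonAssocRing A] [Module k A]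
    [IsScalarTower k A A] [SMulCommClass k A A] {P : A →ₗ[k] A} (hP : RotaBaxterIdentity lam P)
    {x y z : A} (h₁ : x * y * z = x * (y * z)) (h₂ : P x * y * z = P x * (y * z))
    (h₃ : x * P y * z = x * (P y * z)) (h₄ : x * y * P z = x * (y * P z))
    (h₅ : P x * P y * z = P x * (P y * z)) (h₆ : P x * y * P z = P x * (y * P z))
    (h₇ : x * P y * P z = x * (P y * P z)) : P x * P y * P z = P x * (P y * P z) := by
  -- after expansion, the terms of the two sides that do not match one by one are `e₂` and `e₁`
  have e₁ := congrArg (fun t => P (t * z)) (hP x y)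
  have e₂ := congrArg (fun t => P (x * t)) (hP y z)
  simp only [add_mul, mul_add, smul_mul_assoc, mul_smul_comm, map_add, map_smul, h₅] at e₁ e₂
  rw [hP x y, hP y z, add_mul, add_mul, smul_mul_assoc, mul_add, mul_add, mul_smul_comm,
    hP (x * P y) z, hP (P x * y) z, hP (x * y) z, hP x (y * P z), hP x (P y * z), hP x (y * z),
    h₁, h₂, h₃, h₄, h₆, h₇]
  linear_combination (norm := module) e₂ - e₁

/-- Associativity on basis elements, by induction on the total size: concatenations are pulled out
of the product until all three factors are trees, and grafted trees are treated with the
Rota-Baxter identity. -/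
theorem basis_mul_assoc (F G H : LForest X) :
    basis lam F * basis lam G * basis lam H = basis lam F * (basis lam G * basis lam H) := by
  match F, G, H with
  | .cons T F, G, H => rw [cons_mul, conc_mul, cons_mul, basis_mul_assoc F G H]
  | .single T, .cons S G, H => rw [basis_cons, mul_conc, conc_mul, conc_mul, mul_conc]
  | .single T, .single S, .cons U H =>
    have hH : 0 < sizeOf H := by cases H <;> simp
    rw [basis_cons, mul_conc, mul_conc, mul_conc,
      basis_mul_assoc (.single T) (.single S) (.single U)]
  | .single (.leaf x), .single S, .single U => rw [leaf_mul, leaf_mul, conc_mul]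
  | .single (.graft F), .single (.leaf x), .single U =>
    rw [mul_leaf, conc_mul, leaf_mul, mul_conc, mul_leaf, conc_assoc]
  | .single (.graft F), .single (.graft G), .single (.leaf x) =>
    rw [mul_leaf, mul_leaf, mul_conc]
  | .single (.graft F), .single (.graft G), .single (.graft H) =>
    have h₁ := basis_mul_assoc F G H
    have h₂ := basis_mul_assoc (.single (.graft F)) G H
    have h₃ := basis_mul_assoc F (.single (.graft G)) H
    have h₄ := basis_mul_assoc F G (.single (.graft H))
    have h₅ := basis_mul_assoc (.single (.graft F)) (.single (.graft G)) H
    have h₆ := basis_mul_assoc (.single (.graft F)) G (.single (.graft H))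
    have h₇ := basis_mul_assoc F (.single (.graft G)) (.single (.graft H))
    simp only [← graft_basis] at *
    exact rotaBaxter.mul_assoc h₁ h₂ h₃ h₄ h₅ h₆ h₇
termination_by sizeOf F + sizeOf G + sizeOf H

theorem isNonunitaryRotaBaxterAlgebra :
    IsNonunitaryRotaBaxterAlgebra lam (graft lam (X := X)) where
  smul_mul := smul_mul_assoc
  mul_smul c x y := mul_smul_comm c x y
  mul_assoc a b c := by
    induction a using BasisAlgebra.induction with
    | zero => simp
    | add a a' ha ha' => simp [ha, ha', add_mul]
    | smul r a ha => simp [ha, smul_mul_assoc]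
    | basis F =>
    induction b using BasisAlgebra.induction with
    | zero => simp
    | add a a' ha ha' => simp [ha, ha', add_mul, mul_add]
    | smul r a ha => simp [ha, smul_mul_assoc, mul_smul_comm]
    | basis G =>
    induction c using BasisAlgebra.induction with
    | zero => simp
    | add a a' ha ha' => simp [ha, ha', mul_add]
    | smul r a ha => simp [ha, mul_smul_comm]
    | basis H => exact basis_mul_assoc F G H
  rotaBaxter := rotaBaxter

end ForestAlgebra

/-! ### Evaluation of forests in a Rota-Baxter algebra -/

section Eval

variable {X : Type u} {R : Type t} [Mul R]

mutual

/-- The value of a tree in `R`, for the values `f` of the leaves and the operator `Q` in place of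
grafting. -/
def LTree.eval (Q : R → R) (f : X → R) : LTree X → R
  | .leaf x => f x
  | .graft F => Q (LForest.eval Q f F)

/-- The value of a forest in `R`: the product of the values of its trees. -/
def LForest.eval (Q : R → R) (f : X → R) : LForest X → R
  | .single T => LTree.eval Q f T
  | .cons T F => LTree.eval Q f T * LForest.eval Q f F

end

end Eval

theorem LForest.eval_append {X : Type u} {R : Type t} [Semigroup R] (Q : R → R) (f : X → R)
    (F G : LForest X) : (append F G).eval Q f = F.eval Q f * G.eval Q f := by
  match F with
  | .single T => simp only [append, eval]
  | .cons T F => simp only [append, eval, eval_append Q f F G, mul_assoc]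

/-- Evaluation is multiplicative: the recursion that defines the product of forests only uses
associativity and the Rota-Baxter identity. -/
theorem LForest.linearCombination_eval_diamond {k : Type v} [CommRing k] {lam : k} {X : Type u}
    {R : Type t} [NonUnitalRing R] [Module k R] [IsScalarTower k R R] [SMulCommClass k R R]
    {Q : R →ₗ[k] R} (hQ : RotaBaxterIdentity lam Q) (f : X → R) (F G : LForest X) :
    Finsupp.linearCombination k (eval Q f) (diamond lam F G) = F.eval Q f * G.eval Q f := by
  have push (L : R →ₗ[k] R) (g : LForest X → LForest X)
      (hg : ∀ H, (g H).eval Q f = L (H.eval Q f)) (a : LForest X →₀ k) :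
      Finsupp.linearCombination k (eval Q f) (Finsupp.mapDomain g a) =
        L (Finsupp.linearCombination k (eval Q f) a) := by
    rw [Finsupp.linearCombination_mapDomain, Finsupp.apply_linearCombination]
    exact congrArg (fun h => Finsupp.linearCombination k h a) (funext hg)
  fun_induction diamond lam F G with
  | case1 T F G ih =>
    rw [push (LinearMap.mulLeft k (T.eval Q f)) _ (fun H => by simp only [eval]; rfl), ih]
    simp only [LinearMap.mulLeft_apply, eval, mul_assoc]
  | case2 T T' G ih =>
    rw [push (LinearMap.mulRight k (G.eval Q f)) _ (fun H => eval_append Q f H G), ih]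
    simp only [LinearMap.mulRight_apply, eval, mul_assoc]
  | case3 x T' => simp [eval]
  | case4 F x => simp [eval]
  | case5 F F' ih1 ih2 ih3 =>
    rw [push Q _ (fun H => by simp only [grafting, eval, LTree.eval]), map_add, map_add, map_add,
      map_add, map_smul, map_smul, ih1, ih2, ih3]
    simp only [eval, LTree.eval]
    exact (hQ _ _).symm

/-! ### The algebra of leaf-spaced forests -/

namespace LeafAlgebra

open BasisAlgebra

variable {k : Type v} [CommRing k] {lam : k} {X : Type u}

theorem mapDomain_val_diamond (F G : LSForest X) :
    Finsupp.mapDomain Subtype.val (LSForest.diamond lam F G) = LForest.diamond lam F.1 G.1 :=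
  mapDomain_val_supportedEquivFinsupp _ _

/-- The inclusion of the algebra of leaf-spaced forests into the algebra of all forests. -/
def incl (lam : k) (X : Type u) : LeafAlgebra lam X →ₙₐ[k] ForestAlgebra lam X :=
  BasisAlgebra.map Subtype.val mapDomain_val_diamond

theorem incl_injective : Function.Injective (incl lam X) :=
  map_injective _ _ Subtype.val_injective

theorem incl_grafting (a : LeafAlgebra lam X) :
    incl lam X (grafting lam X a) = ForestAlgebra.graft lam (incl lam X a) := by
  rw [incl, grafting, ForestAlgebra.graft]
  exact map_mapBasis Subtype.val mapDomain_val_diamond LSForest.grafting LForest.grafting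
    (fun _ => rfl) a

theorem isNonunitaryRotaBaxterAlgebra :
    IsNonunitaryRotaBaxterAlgebra lam (grafting lam X) :=
  ForestAlgebra.isNonunitaryRotaBaxterAlgebra.of_injective (incl lam X) incl_injective
    incl_grafting

/-- In a leaf-spaced forest, one of the first two trees is a leaf, so that the forest is the product
of its first tree and the rest. -/
theorem of_single_mul_of {T : LTree X} {F : LForest X} (h : (LForest.cons T F).LeafSpaced)
    (hT : (LForest.single T).LeafSpaced) (hF : F.LeafSpaced) :
    (of _ ⟨.single T, hT⟩ * of _ ⟨F, hF⟩ : LeafAlgebra lam X) = of _ ⟨.cons T F, h⟩ := by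
  apply incl_injective
  rw [map_mul]
  simp only [incl, map_of]
  rw [LForest.LeafSpaced] at h
  match T, F with
  | .leaf x, F =>
    exact (ForestAlgebra.leaf_mul_basis x F).trans (ForestAlgebra.basis_cons _ _).symm
  | .graft G, .single (.leaf x) =>
    exact (ForestAlgebra.basis_mul_leaf _ x).trans (ForestAlgebra.basis_cons _ _).symm
  | .graft G, .cons (.leaf x) F =>
    refine (ForestAlgebra.tree_mul_cons _ _ _).trans ?_
    rw [ForestAlgebra.basis_mul_leaf, ForestAlgebra.conc_assoc, ← ForestAlgebra.basis_cons]
    exact (ForestAlgebra.basis_cons _ _).symm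
  | .graft G, .single (.graft G') => exact absurd ⟨trivial, trivial⟩ h.2.2
  | .graft G, .cons (.graft G') F => exact absurd ⟨trivial, trivial⟩ h.2.2

theorem grafting_of {F : LForest X} (hF : F.LeafSpaced)
    (h : (LForest.single (.graft F)).LeafSpaced) :
    grafting lam X (of _ ⟨F, hF⟩) = of _ ⟨.single (.graft F), h⟩ :=
  mapBasis_of _ _

/-- The leaves generate the algebra of leaf-spaced forests under product and grafting. -/
theorem apply_of_eq {R : Type t} [NonUnitalRing R] [Module k R] (Q : R →ₗ[k] R)
    {f g : LeafAlgebra lam X →ₙₐ[k] R} (hf : ∀ a, f (grafting lam X a) = Q (f a))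
    (hg : ∀ a, g (grafting lam X a) = Q (g a))
    (h : ∀ x, f (of _ (LSForest.leaf x)) = g (of _ (LSForest.leaf x)))
    (F : LForest X) (hF : F.LeafSpaced) : f (of _ ⟨F, hF⟩) = g (of _ ⟨F, hF⟩) := by
  match F with
  | .single (.leaf x) => exact h x
  | .single (.graft F) =>
    have hF' : F.LeafSpaced := by rwa [LForest.LeafSpaced, LTree.LeafSpaced] at hF
    rw [← grafting_of hF', hf, hg, apply_of_eq Q hf hg h F hF']
  | .cons T F =>
    have hF' := hF
    rw [LForest.LeafSpaced] at hF'
    have hT : (LForest.single T).LeafSpaced := by rw [LForest.LeafSpaced]; exact hF'.1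
    have hlt : 0 < sizeOf F := by cases F <;> simp
    rw [← of_single_mul_of hF hT hF'.2.1, map_mul, map_mul, apply_of_eq Q hf hg h F hF'.2.1,
      apply_of_eq Q hf hg h (.single T) hT]
termination_by sizeOf F

theorem isFree : IsFreeNonunitaryRotaBaxterAlgebra.{u, v, max u v, t} lam (grafting lam X)
    (fun x => of _ (LSForest.leaf x)) := by
  refine ⟨isNonunitaryRotaBaxterAlgebra, fun R _ _ _ _ Q hQ f => ?_⟩
  let E : ForestAlgebra lam X →ₙₐ[k] R :=
    lift (LForest.eval Q f) (LForest.linearCombination_eval_diamond hQ f)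
  have hE (a : ForestAlgebra lam X) : E (ForestAlgebra.graft lam a) = Q (E a) := by
    induction a using BasisAlgebra.induction with
    | zero => simp
    | add a b ha hb => simp [ha, hb]
    | smul c a ha => simp [ha]
    | basis F =>
      rw [ForestAlgebra.graft_basis]
      simp only [E, lift_of, LForest.eval, LTree.eval]
  have hg : (∀ a, E.comp (incl lam X) (grafting lam X a) = Q (E.comp (incl lam X) a)) ∧
      ∀ x, E.comp (incl lam X) (of _ (LSForest.leaf x)) = f x := by
    refine ⟨fun a => ?_, fun x => ?_⟩
    · rw [NonUnitalAlgHom.comp_apply, NonUnitalAlgHom.comp_apply, incl_grafting, hE]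
    · rw [NonUnitalAlgHom.comp_apply]
      simp only [E, incl, map_of, lift_of, LSForest.leaf, LForest.eval, LTree.eval]
  refine ⟨E.comp (incl lam X), hg, fun g' hg' => hom_ext fun F => ?_⟩
  exact apply_of_eq Q hg'.1 hg.1 (fun x => (hg'.2 x).trans (hg.2 x).symm) F.1 F.2

end LeafAlgebra

/-! ### The word of a forest -/

mutual

/-- The Motzkin path of a tree: a level step for a leaf, the raised path of `F` for the grafting
of `F`. -/
def LTree.word {X : Type u} : LTree X → List (MStep X)
  | .leaf x => [.level x]
  | .graft F => Motzkin.raise (LForest.word F)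

/-- The Motzkin path of a forest: the link product of the paths of its trees. -/
def LForest.word {X : Type u} : LForest X → List (MStep X)
  | .single T => LTree.word T
  | .cons T F => LTree.word T ++ LForest.word F

end

namespace LForest

open Motzkin

variable {X : Type u}

theorem word_append (F G : LForest X) : (append F G).word = F.word ++ G.word := by
  match F with
  | .single T => simp only [append, word]
  | .cons T F => simp only [append, word, word_append F G, List.append_assoc]

theorem word_grafting (F : LForest X) : (grafting F).word = Motzkin.raise F.word := by
  simp only [grafting, word, LTree.word]

mutual

theorem _root_.LTree.word_mem (T : LTree X) : IsMotzkin T.word ∧ PeakFree T.word := by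
  match T with
  | .leaf x => rw [LTree.word]; exact (PeakFreePath.level x).2
  | .graft F =>
    rw [LTree.word]
    exact ⟨isMotzkin_raise F.word_mem.1, peakFree_raise F.word_mem.1 F.word_mem.2⟩

theorem word_mem (F : LForest X) : IsMotzkin F.word ∧ PeakFree F.word := by
  match F with
  | .single T => rw [word]; exact T.word_mem
  | .cons T F =>
    rw [word]
    exact ⟨isMotzkin_link T.word_mem.1 F.word_mem.1,
      peakFree_link T.word_mem.1 T.word_mem.2 F.word_mem.2⟩

end

theorem word_append_ne_down_cons (F : LForest X) (u u' : List (MStep X)) :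
    F.word ++ u ≠ .down :: u' := by
  intro h
  have h1 := head?_ne_down F.word_mem.1
  rw [← List.head?_append_of_ne_nil _ F.word_mem.2.1 (l₂ := u), h] at h1
  exact h1 rfl

mutual

/-- The words of trees form a prefix code. -/
theorem _root_.LTree.word_append_inj (T T' : LTree X) (u u' : List (MStep X))
    (h : T.word ++ u = T'.word ++ u') : T = T' ∧ u = u' := by
  match T, T' with
  | .leaf x, .leaf x' => simpa [LTree.word] using h
  | .leaf x, .graft F => simp [LTree.word, Motzkin.raise] at h
  | .graft F, .leaf x => simp [LTree.word, Motzkin.raise] at h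
  | .graft F, .graft F' =>
    simp only [LTree.word, Motzkin.raise, List.cons_append, List.append_assoc, List.nil_append,
      List.cons.injEq, true_and] at h
    obtain ⟨rfl, rfl⟩ := word_append_down_inj F F' u u' h
    exact ⟨rfl, rfl⟩

/-- The down step following each word marks its end: it cannot start another tree. -/
theorem word_append_down_inj (F F' : LForest X) (u u' : List (MStep X))
    (h : F.word ++ .down :: u = F'.word ++ .down :: u') : F = F' ∧ u = u' := by
  match F, F' with
  | .single T, .single T' =>
    rw [word, word] at h
    obtain ⟨rfl, h'⟩ := LTree.word_append_inj T T' _ _ h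
    exact ⟨rfl, List.tail_eq_of_cons_eq h'⟩
  | .single T, .cons T' F' =>
    rw [word, word, List.append_assoc] at h
    exact absurd (LTree.word_append_inj T T' _ _ h).2.symm (word_append_ne_down_cons _ _ _)
  | .cons T F, .single T' =>
    rw [word, word, List.append_assoc] at h
    exact absurd (LTree.word_append_inj T T' _ _ h).2 (word_append_ne_down_cons _ _ _)
  | .cons T F, .cons T' F' =>
    rw [word, word, List.append_assoc, List.append_assoc] at h
    obtain ⟨rfl, h'⟩ := LTree.word_append_inj T T' _ _ h
    obtain ⟨rfl, rfl⟩ := word_append_down_inj F F' u u' h'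
    exact ⟨rfl, rfl⟩

end

theorem word_injective : Function.Injective (word (X := X)) := fun F F' h =>
  (word_append_down_inj F F' [] [] (by rw [h])).1

/-- Every peak-free Motzkin path is the word of a forest, by decomposition at the first return to
the axis. -/
theorem exists_word_eq (m : List (MStep X)) (hm : IsMotzkin m) (hp : PeakFree m) :
    ∃ F : LForest X, F.word = m := by
  obtain ⟨h1, h2, h3⟩ := firstReturn_spec hm hp.1
  have hpk := hp.2
  rw [← List.take_append_drop (firstReturn m) m, List.isChain_append] at hpk
  have hne : 0 < m.length := List.length_pos_iff.2 hp.1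
  have hM := isMotzkin_take hm h2
  have htree : ∃ T : LTree X, T.word = m.take (firstReturn m) := by
    match hw : m.take (firstReturn m) with
    | [] =>
      have := congrArg List.length hw
      simp only [List.length_take, List.length_nil] at this
      omega
    | .down :: r => exact absurd (by rw [hw]; rfl) (head?_ne_down hM)
    | .level x :: r =>
      -- the first return happens right after a level step
      have h4 : firstReturn m = 1 := by
        by_contra hne1
        refine h3 1 one_pos (by omega) ?_
        have h5 := congrArg (List.take 1) hw
        rw [List.take_take, min_eq_left (by omega)] at h5
        rw [h5]
        simp [height, rise]
      have h6 := congrArg List.length hw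
      simp only [List.length_take, List.length_cons] at h6
      have h7 : r = [] := List.length_eq_zero_iff.1 (by omega)
      exact ⟨.leaf x, by rw [h7, LTree.word]⟩
    | .up :: r =>
      have hlen := congrArg List.length hw
      simp only [List.length_take, List.length_cons] at hlen
      have hr := prime_eq_raise (hw ▸ hM) (by
        intro j hj hlt
        rw [← hw] at hlt ⊢
        simp only [List.length_take] at hlt
        rw [List.take_take, min_eq_left (by omega)]
        exact h3 j hj (by omega))
      have hc := hpk.1
      rw [hw, hr.1] at hc
      -- otherwise the path starts with a peak
      have hr0 : r.dropLast ≠ [] := by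
        intro h
        rw [h] at hc
        simp [Motzkin.raise] at hc
      rw [Motzkin.raise, List.isChain_cons, List.isChain_append] at hc
      have hlt : r.length - 1 < m.length := by omega
      obtain ⟨F, hF⟩ := exists_word_eq r.dropLast hr.2 ⟨hr0, hc.2.1⟩
      exact ⟨.graft F, by rw [LTree.word, hF, ← hr.1]⟩
  obtain ⟨T, hT⟩ := htree
  by_cases hd : m.drop (firstReturn m) = []
  · refine ⟨.single T, ?_⟩
    rw [word, hT]
    conv_rhs => rw [← List.take_append_drop (firstReturn m) m, hd, List.append_nil]
  · have hlt : (m.drop (firstReturn m)).length < m.length := by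
      rw [List.length_drop]
      omega
    obtain ⟨F, hF⟩ := exists_word_eq _ (isMotzkin_drop hm h2) ⟨hd, hpk.2.1⟩
    exact ⟨.cons T F, by rw [word, hT, hF, List.take_append_drop]⟩
termination_by m.length

theorem _root_.LTree.head?_word (T : LTree X) : T.word.head? = some .up ↔ T.IsNonLeaf := by
  cases T <;> simp [LTree.word, LTree.IsNonLeaf, Motzkin.raise]

theorem _root_.LTree.getLast?_word (T : LTree X) :
    T.word.getLast? = some .down ↔ T.IsNonLeaf := by
  cases T with
  | leaf x => simp [LTree.word, LTree.IsNonLeaf]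
  | graft F =>
    rw [LTree.word, Motzkin.raise, ← List.cons_append, List.getLast?_concat]
    simp [LTree.IsNonLeaf]

theorem head?_word (F : LForest X) : F.word.head? = some .up ↔ F.first.IsNonLeaf := by
  match F with
  | .single T => rw [word, first, T.head?_word]
  | .cons T F => rw [word, first, List.head?_append_of_ne_nil _ T.word_mem.2.1, T.head?_word]

mutual

theorem _root_.LTree.valleyFree_word (T : LTree X) : ValleyFree T.word ↔ T.LeafSpaced := by
  match T with
  | .leaf x => simp [LTree.word, LTree.LeafSpaced, ValleyFree]
  | .graft F =>
    rw [LTree.word, LTree.LeafSpaced, ← F.valleyFree_word, ValleyFree, ValleyFree, Motzkin.raise,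
      List.isChain_cons, List.isChain_append]
    simp

/-- Valleys between two consecutive indecomposable factors correspond to adjacent non-leaf
trees. -/
theorem valleyFree_word (F : LForest X) : ValleyFree F.word ↔ F.LeafSpaced := by
  match F with
  | .single T => rw [word, LeafSpaced, T.valleyFree_word]
  | .cons T F =>
    rw [word, LeafSpaced, ← T.valleyFree_word, ← F.valleyFree_word, ValleyFree, ValleyFree,
      ValleyFree, List.isChain_append, ← T.getLast?_word, ← F.head?_word]
    refine and_congr_right fun _ => and_congr_right fun _ => ⟨fun h h' => ?_, ?_⟩
    · exact h _ h'.1 _ h'.2 ⟨rfl, rfl⟩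
    · rintro h x hx y hy ⟨rfl, rfl⟩
      exact h ⟨hx, hy⟩

end

end LForest

/-! ### The product of paths -/

namespace Motzkin

variable {X : Type u}

theorem lastVisit_append {p m : List (MStep X)} (hp : height p = 0) (hm : m ≠ []) :
    lastVisit (p ++ m) = p.length + lastVisit m := by
  obtain ⟨h1, h2, h3⟩ := lastVisit_spec hm
  obtain ⟨g1, g2, g3⟩ := lastVisit_spec (m := p ++ m) (by simp [hm])
  have ht (j : ℕ) : height ((p ++ m).take (p.length + j)) = height (m.take j) := by
    rw [List.take_length_add_append, height_append, hp, zero_add]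
  rw [List.length_append] at g1 g3
  rcases lt_trichotomy (lastVisit (p ++ m)) (p.length + lastVisit m) with h | h | h
  · exact absurd ((ht _).trans h2) (g3 _ h (by omega))
  · exact h
  · obtain ⟨j, hj⟩ := Nat.exists_eq_add_of_le (show p.length ≤ lastVisit (p ++ m) by omega)
    rw [hj, ht] at g2
    exact absurd g2 (h3 j (by omega) (by omega))

theorem firstReturn_le {m : List (MStep X)} (hm : IsMotzkin m) (h0 : m ≠ []) :
    firstReturn m ≤ m.length :=
  Nat.sInf_le ⟨List.length_pos_iff.2 h0, by rw [List.take_length]; exact hm.2⟩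

theorem firstReturn_append {m p : List (MStep X)} (hm : IsMotzkin m) (hm0 : m ≠ [])
    (hp : IsMotzkin p) : firstReturn (m ++ p) = firstReturn m := by
  obtain ⟨h1, h2, h3⟩ := firstReturn_spec hm hm0
  obtain ⟨g1, g2, g3⟩ := firstReturn_spec (isMotzkin_link hm hp) (by simp [link, hm0])
  rw [link] at g1 g2 g3
  have hle := firstReturn_le hm hm0
  have ht (j : ℕ) (hj : j ≤ m.length) : (m ++ p).take j = m.take j :=
    List.take_append_of_le_length hj
  rcases lt_trichotomy (firstReturn (m ++ p)) (firstReturn m) with h | h | h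
  · rw [ht _ (by omega)] at g2
    exact absurd g2 (h3 _ g1 h)
  · exact h
  · exact absurd (by rw [ht _ hle]; exact h2) (g3 _ h1 h)

theorem height_take_raise_ne {a : List (MStep X)} (ha : IsMotzkin a) {j : ℕ} (h0 : 0 < j)
    (hj : j < (raise a).length) : height ((raise a).take j) ≠ 0 := by
  obtain ⟨j, rfl⟩ := Nat.exists_eq_succ_of_ne_zero h0.ne'
  simp only [raise, List.length_cons, List.length_append, List.length_nil] at hj
  rw [raise, List.take_succ_cons, List.take_append_of_le_length (by omega), height_cons]
  have := ha.1 j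
  simp only [rise]
  omega

theorem lastVisit_raise {a : List (MStep X)} (ha : IsMotzkin a) : lastVisit (raise a) = 0 := by
  obtain ⟨h1, h2, -⟩ := lastVisit_spec (m := raise a) (by simp [raise])
  by_contra h
  exact height_take_raise_ne ha (Nat.pos_of_ne_zero h) h1 h2

theorem firstReturn_raise {a : List (MStep X)} (ha : IsMotzkin a) :
    firstReturn (raise a) = (raise a).length := by
  have h0 : raise a ≠ [] := by simp [raise]
  obtain ⟨h1, h2, -⟩ := firstReturn_spec (isMotzkin_raise ha) h0
  by_contra h
  exact height_take_raise_ne ha h1 (lt_of_le_of_ne (firstReturn_le (isMotzkin_raise ha) h0) h) h2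

section Diamond

variable {k : Type v} [CommRing k] (lam : k)

theorem diamond_of_up {m m' r r' : List (MStep X)} (h : m.drop (lastVisit m) = .up :: r)
    (h' : m'.take (firstReturn m') = .up :: r') :
    diamond lam m m' = Finsupp.mapDomain
      (fun c => link (m.take (lastVisit m)) (link (raise c) (m'.drop (firstReturn m'))))
      (diamond lam r.dropLast (.up :: r') + diamond lam (.up :: r) r'.dropLast
        + lam • diamond lam r.dropLast r'.dropLast) := by
  rw [diamond]
  split
  · next r₁ r₁' h₁ h₁' =>
    obtain rfl : r₁ = r := List.tail_eq_of_cons_eq (h₁.symm.trans h)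
    obtain rfl : r₁' = r' := List.tail_eq_of_cons_eq (h₁'.symm.trans h')
    rfl
  · next hno => exact absurd h' (hno _ _ h)

theorem diamond_of_not_up {m m' : List (MStep X)}
    (h : ∀ r r', m.drop (lastVisit m) = .up :: r → m'.take (firstReturn m') ≠ .up :: r') :
    diamond lam m m' = Finsupp.single (link m m') 1 := by
  rw [diamond]
  split
  · next r₁ r₁' h₁ h₁' => exact absurd h₁' (h _ _ h₁)
  · rfl

/-- Only the last indecomposable factor of the left path enters the product. -/
theorem diamond_append_left {p m : List (MStep X)} (hp : height p = 0) (hm : m ≠ [])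
    (m' : List (MStep X)) :
    diamond lam (p ++ m) m' = Finsupp.mapDomain (p ++ ·) (diamond lam m m') := by
  have hd : (p ++ m).drop (lastVisit (p ++ m)) = m.drop (lastVisit m) := by
    rw [lastVisit_append hp hm, List.drop_length_add_append]
  have ht : (p ++ m).take (lastVisit (p ++ m)) = p ++ m.take (lastVisit m) := by
    rw [lastVisit_append hp hm, List.take_length_add_append]
  by_cases h : ∃ r r', m.drop (lastVisit m) = .up :: r ∧ m'.take (firstReturn m') = .up :: r'
  · obtain ⟨r, r', h, h'⟩ := h
    rw [diamond_of_up lam (hd.trans h) h', diamond_of_up lam h h', ← Finsupp.mapDomain_comp, ht]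
    congr 1
    funext c
    simp [link]
  · have hno : ∀ r r', m.drop (lastVisit m) = .up :: r → m'.take (firstReturn m') ≠ .up :: r' :=
      fun r r' h₁ h₂ => h ⟨r, r', h₁, h₂⟩
    rw [diamond_of_not_up lam hno, diamond_of_not_up lam (hd ▸ hno), Finsupp.mapDomain_single]
    simp [link]

/-- Only the first indecomposable factor of the right path enters the product. -/
theorem diamond_append_right {m' p : List (MStep X)} (hm : IsMotzkin m') (hm0 : m' ≠ [])
    (hp : IsMotzkin p) (m : List (MStep X)) :
    diamond lam m (m' ++ p) = Finsupp.mapDomain (· ++ p) (diamond lam m m') := by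
  have hle := firstReturn_le hm hm0
  have ht : (m' ++ p).take (firstReturn (m' ++ p)) = m'.take (firstReturn m') := by
    rw [firstReturn_append hm hm0 hp, List.take_append_of_le_length hle]
  have hd : (m' ++ p).drop (firstReturn (m' ++ p)) = m'.drop (firstReturn m') ++ p := by
    rw [firstReturn_append hm hm0 hp, List.drop_append_of_le_length hle]
  by_cases h : ∃ r r', m.drop (lastVisit m) = .up :: r ∧ m'.take (firstReturn m') = .up :: r'
  · obtain ⟨r, r', h, h'⟩ := h
    rw [diamond_of_up lam h (ht.trans h'), diamond_of_up lam h h', ← Finsupp.mapDomain_comp, hd]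
    congr 1
    funext c
    simp [link]
  · have hno : ∀ r r', m.drop (lastVisit m) = .up :: r → m'.take (firstReturn m') ≠ .up :: r' :=
      fun r r' h₁ h₂ => h ⟨r, r', h₁, h₂⟩
    rw [diamond_of_not_up lam hno, diamond_of_not_up lam (ht ▸ hno), Finsupp.mapDomain_single]
    simp [link]

theorem diamond_raise_raise {a b : List (MStep X)} (ha : IsMotzkin a) (hb : IsMotzkin b) :
    diamond lam (raise a) (raise b) = Finsupp.mapDomain raise
      (diamond lam a (raise b) + diamond lam (raise a) b + lam • diamond lam a b) := by
  have h : (raise a).drop (lastVisit (raise a)) = .up :: (a ++ [.down]) := by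
    rw [lastVisit_raise ha]; rfl
  have h' : (raise b).take (firstReturn (raise b)) = .up :: (b ++ [.down]) := by
    rw [firstReturn_raise hb, List.take_length]; rfl
  rw [diamond_of_up lam h h', lastVisit_raise ha, firstReturn_raise hb, List.dropLast_concat,
    List.dropLast_concat, List.drop_length]
  congr 1
  funext c
  simp [link]

theorem diamond_level_left (x : X) (m : List (MStep X)) :
    diamond lam [.level x] m = Finsupp.single (.level x :: m) 1 := by
  refine diamond_of_not_up lam fun r r' h _ => ?_
  have h1 := (lastVisit_spec (m := [MStep.level x]) (by simp)).1
  rw [List.length_singleton, Nat.lt_one_iff] at h1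
  simp [h1] at h

theorem diamond_level_right (x : X) (m : List (MStep X)) :
    diamond lam m [.level x] = Finsupp.single (m ++ [.level x]) 1 := by
  refine diamond_of_not_up lam fun r r' _ h => ?_
  cases hn : firstReturn [MStep.level x] <;> simp [hn] at h

/-- The word of a forest turns the product of forests into the product of paths. -/
theorem diamond_word (F G : LForest X) :
    diamond lam F.word G.word = Finsupp.mapDomain LForest.word (LForest.diamond lam F G) := by
  fun_induction LForest.diamond lam F G with
  | case1 T F G ih =>
    rw [LForest.word, diamond_append_left lam T.word_mem.1.2 F.word_mem.2.1, ih,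
      ← Finsupp.mapDomain_comp, ← Finsupp.mapDomain_comp]
    refine congrArg (fun g => Finsupp.mapDomain g (LForest.diamond lam F G)) (funext fun H => ?_)
    simp only [Function.comp_apply, LForest.word]
  | case2 T T' G ih =>
    have h : (LForest.cons T' G).word = (LForest.single T').word ++ G.word := by
      simp only [LForest.word]
    have hT := LForest.word_mem (.single T')
    rw [h, diamond_append_right lam hT.1 hT.2.1 G.word_mem.1, ih,
      ← Finsupp.mapDomain_comp, ← Finsupp.mapDomain_comp]
    congr 1
    funext H
    simp only [Function.comp_apply, LForest.word_append]
  | case3 x T' =>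
    simp only [LForest.word, LTree.word, diamond_level_left, Finsupp.mapDomain_single,
      List.singleton_append]
  | case4 F x =>
    simp only [LForest.word, LTree.word, diamond_level_right, Finsupp.mapDomain_single]
  | case5 F F' ih1 ih2 ih3 =>
    have h (F : LForest X) : (LForest.single (.graft F)).word = raise F.word := F.word_grafting
    rw [h] at ih1 ih2
    rw [h, h, diamond_raise_raise lam F.word_mem.1 F'.word_mem.1, ih1, ih2, ih3,
      ← Finsupp.mapDomain_smul, ← Finsupp.mapDomain_add, ← Finsupp.mapDomain_add,
      ← Finsupp.mapDomain_comp, ← Finsupp.mapDomain_comp]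
    congr 1

end Diamond

end Motzkin

/-! ### Peak-free paths and forests -/

namespace LForest

open Motzkin

variable {X : Type u}

/-- The bijection between forests and peak-free Motzkin paths. -/
def toPath (X : Type u) : LForest X ≃ PeakFreePath X :=
  Equiv.ofBijective (fun F => ⟨F.word, F.word_mem⟩)
    ⟨fun _ _ h => word_injective (congrArg Subtype.val h), fun m => by
      obtain ⟨F, hF⟩ := exists_word_eq m.1 m.2.1 m.2.2
      exact ⟨F, Subtype.ext hF⟩⟩

theorem toPath_append (F G : LForest X) :
    toPath X (append F G) = (toPath X F).link (toPath X G) := Subtype.ext (word_append F G)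

theorem toPath_grafting (F : LForest X) : toPath X (grafting F) = (toPath X F).raise :=
  Subtype.ext (word_grafting F)

theorem toPath_leaf (x : X) : toPath X (.single (.leaf x)) = .level x :=
  Subtype.ext (by change word _ = _; rw [word, LTree.word]; rfl)

theorem isPathToForest_toPath_symm : IsPathToForest (toPath X).symm where
  map_link m m' := by
    rw [Equiv.symm_apply_eq, toPath_append, Equiv.apply_symm_apply, Equiv.apply_symm_apply]
  map_raise m := by rw [Equiv.symm_apply_eq, toPath_grafting, Equiv.apply_symm_apply]
  map_level x := by rw [Equiv.symm_apply_eq, toPath_leaf]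

/-- The three laws of a map from paths to forests determine it on the word of each forest. -/
theorem _root_.IsPathToForest.apply_toPath {ψ : PeakFreePath X → LForest X}
    (hψ : IsPathToForest ψ) (F : LForest X) : ψ (toPath X F) = F := by
  match F with
  | .single (.leaf x) => rw [toPath_leaf, hψ.map_level]
  | .single (.graft F) =>
    exact (congrArg ψ (toPath_grafting F)).trans
      ((hψ.map_raise _).trans (congrArg grafting (hψ.apply_toPath F)))
  | .cons T F =>
    have hlt : 0 < sizeOf F := by cases F <;> simp
    exact (congrArg ψ (toPath_append (.single T) F)).trans ((hψ.map_link _ _).trans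
      (congrArg₂ append (hψ.apply_toPath (.single T)) (hψ.apply_toPath F)))
termination_by sizeOf F

theorem _root_.IsPathToForest.eq_toPath_symm {ψ : PeakFreePath X → LForest X}
    (hψ : IsPathToForest ψ) : ψ = (toPath X).symm := by
  funext m
  rw [← (toPath X).apply_symm_apply m, hψ.apply_toPath, Equiv.symm_apply_apply]

end LForest

/-! ### The algebras of paths and of leaf-spaced forests -/

namespace LSForest

open Motzkin

variable {X : Type u}

/-- The bijection between leaf-spaced forests and peak-free and valley-free Motzkin paths. -/
def toPath (X : Type u) : LSForest X ≃ LVPath X :=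
  Equiv.ofBijective
    (fun F => ⟨F.1.word, F.1.word_mem.1, F.1.word_mem.2, F.1.valleyFree_word.2 F.2⟩)
    ⟨fun _ _ h => Subtype.ext (LForest.word_injective (congrArg Subtype.val h)), fun m => by
      obtain ⟨F, hF⟩ := LForest.exists_word_eq m.1 m.2.1 m.2.2.1
      exact ⟨⟨F, F.valleyFree_word.1 (hF ▸ m.2.2.2)⟩, Subtype.ext hF⟩⟩

theorem toPath_grafting (F : LSForest X) : toPath X (grafting F) = (toPath X F).raise :=
  Subtype.ext (LForest.word_grafting F.1)

theorem toPeakFree_toPath (F : LSForest X) : (toPath X F).toPeakFree = LForest.toPath X F.1 := rfl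

theorem mapDomain_toPath_diamond {k : Type v} [CommRing k] (lam : k) (F G : LSForest X) :
    Finsupp.mapDomain (toPath X) (diamond lam F G) =
      LVPath.diamond lam (toPath X F) (toPath X G) := by
  apply Finsupp.mapDomain_injective Subtype.val_injective
  rw [LVPath.diamond, mapDomain_val_supportedEquivFinsupp, ← Finsupp.mapDomain_comp]
  change Finsupp.mapDomain (LForest.word ∘ Subtype.val) _ = Motzkin.diamond lam F.1.word G.1.word
  rw [Finsupp.mapDomain_comp, LeafAlgebra.mapDomain_val_diamond, diamond_word]

theorem mapDomain_toPath_symm_diamond {k : Type v} [CommRing k] (lam : k) (m m' : LVPath X) :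
    Finsupp.mapDomain (toPath X).symm (LVPath.diamond lam m m') =
      diamond lam ((toPath X).symm m) ((toPath X).symm m') := by
  apply Finsupp.mapDomain_injective (toPath X).injective
  rw [mapDomain_toPath_diamond, ← Finsupp.mapDomain_comp, Equiv.self_comp_symm,
    Finsupp.mapDomain_id, Equiv.apply_symm_apply, Equiv.apply_symm_apply]

end LSForest

end

theorem corollary6p5 {k : Type v} [CommRing k] (lam : k) (X : Type u) :
    (∃ φ : Motzkin.PeakFreePath X → LForest X,
      IsPathToForest φ ∧ (∀ ψ, IsPathToForest ψ → ψ = φ) ∧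
      ∃ e : Motzkin.LVPath X ≃ LSForest X, (∀ m, (e m : LForest X) = φ m.toPeakFree) ∧
      IsNonunitaryRotaBaxterAlgebra lam (MotzkinAlgebra.raising lam X) ∧
      IsNonunitaryRotaBaxterAlgebra lam (LeafAlgebra.grafting lam X) ∧
      ∃ Φ : MotzkinAlgebra lam X →ₙₐ[k] LeafAlgebra lam X,
        Function.Bijective Φ ∧
        (∀ m, Φ (BasisAlgebra.of _ m) = BasisAlgebra.of _ (e m)) ∧
        ∀ a, Φ (MotzkinAlgebra.raising lam X a) = LeafAlgebra.grafting lam X (Φ a)) ∧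
    IsFreeNonunitaryRotaBaxterAlgebra.{u, v, max u v, t} lam (LeafAlgebra.grafting lam X)
      (fun x => BasisAlgebra.of _ (LSForest.leaf x)) := by
  let e := (LSForest.toPath X).symm
  let Φ : MotzkinAlgebra lam X →ₙₐ[k] LeafAlgebra lam X :=
    BasisAlgebra.map e (LSForest.mapDomain_toPath_symm_diamond lam)
  have hΦ (a : MotzkinAlgebra lam X) :
      Φ (MotzkinAlgebra.raising lam X a) = LeafAlgebra.grafting lam X (Φ a) := by
    refine BasisAlgebra.map_mapBasis e (LSForest.mapDomain_toPath_symm_diamond lam)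
      Motzkin.LVPath.raise LSForest.grafting (fun m => ?_) a
    rw [Equiv.symm_apply_eq, LSForest.toPath_grafting, Equiv.apply_symm_apply]
  have hinj : Function.Injective Φ := BasisAlgebra.map_injective _ _ e.injective
  refine ⟨⟨(LForest.toPath X).symm, LForest.isPathToForest_toPath_symm,
    fun ψ hψ => hψ.eq_toPath_symm, e, fun m => ?_,
    LeafAlgebra.isNonunitaryRotaBaxterAlgebra.of_injective Φ hinj hΦ,
    LeafAlgebra.isNonunitaryRotaBaxterAlgebra, Φ,
    ⟨hinj, BasisAlgebra.map_surjective _ _ e.surjective⟩,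
    fun m => BasisAlgebra.map_of _ _ m, hΦ⟩, LeafAlgebra.isFree⟩
  rw [Equiv.eq_symm_apply, ← LSForest.toPeakFree_toPath, Equiv.apply_symm_apply]
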